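/- Notation. For $S\subset[0,1]^2$, $F\in L^\infty([0,1]^2)$ (complex valued) and $x\in\mathbb R^3$ let $E_SF(x)=\int_S F(\xi)\,e^{2\pi i(\xi,|\xi|^2)\cdot x}\,d\xi$, and $EF=E_{[0,1]^2}F$. For $R=n^2$ with $n\ge 1$ an integer, let $\mathcal Q_R$ be the set of the $R$ squares $[\frac jn,\frac{j+1}n]\times[\frac in,\frac{i+1}n]$, $0\le i,j<n$. For a ball $B$ in $\mathbb R^3$ with centre $c$ and radius $r$ write $w_B(x)=(1+|x-c|/r)^{-100}$. For all such $R$ and every positive integer $M$ dividing $R$, fix a partition of $\mathcal Q_R$ into $M$ classes $S_1,\dots,S_M$ (depending on $R$ and $M$), each consisting of $R/M$ squares. Let $\mathbf P_{R,M}$ be the set of all unordered partitions $\mathcal P=\{P_1,\dots,P_{R/M}\}$ of $\mathcal Q_R$ such that each cell $P_j$ contains exactly one square from each class $S_k$, and identify $P_j$ with the union of its squares. Theorem. Assume that there is $\gamma_0>0$ such that for every $0<\gamma<\gamma_0$ and every $\epsilon>0$ there is a constant $C_{\gamma,\epsilon}$ such that for all $R=n^2$, all $M$ dividing $R$ with $\frac12R^{1-\gamma}\le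 M\le 2R^{1-\gamma}$, all $F\in L^\infty([0,1]^2)$ and all balls $B_R$ of radius $R$ in $\mathbb R^3$, $$\int_{B_R}|EF|^3\le C_{\gamma,\epsilon}R^{\epsilon}\,\frac1{\#\mathbf P_{R,M}}\sum_{\mathcal P\in\mathbf P_{R,M}}\Big(\frac RM\Big)^{1/2}\sum_{j=1}^{R/M}\int_{\mathbb R^3}|E_{P_j}F|^3\,w_{B_R}.$$ Then the Restriction conjecture for the paraboloid $\mathbb P^2$ holds: for every $\epsilon>0$ there is a constant $C_\epsilon$ such that for all real $R\ge1$, all $F\in L^\infty([0,1]^2)$ and all balls $B_{\sqrt R}$ of radius $\sqrt R$ in $\mathbb R^3$, $$\int_{B_{\sqrt R}}|EF|^3\le C_\epsilon R^\epsilon\|F\|_\infty^3.$$ -/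

import Mathlib

namespace LargeEnsemble

open MeasureTheory

noncomputable section

/-- The unit square `[0,1]²`. -/
def unitSquare : Set (ℝ × ℝ) := Set.Icc 0 1 ×ˢ Set.Icc 0 1

/-- `(ξ, |ξ|²) · x`, the pairing of `x ∈ ℝ³` with the lift of `ξ ∈ ℝ²` to the paraboloid. -/
def phase (ξ : ℝ × ℝ) (x : EuclideanSpace ℝ (Fin 3)) : ℝ :=
  ξ.1 * x 0 + ξ.2 * x 1 + (ξ.1 ^ 2 + ξ.2 ^ 2) * x 2

/-- `E_S F(x) = ∫_S F(ξ) e((ξ, |ξ|²) · x) dξ`, where `e(t) = exp(2πit)`. -/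
def extensionOp (S : Set (ℝ × ℝ)) (F : ℝ × ℝ → ℂ) (x : EuclideanSpace ℝ (Fin 3)) : ℂ :=
  ∫ ξ in S, F ξ * Complex.exp (2 * Real.pi * phase ξ x * Complex.I)

/-- The square with lower left corner `(j/n, i/n)` and side `1/n`. With `R = n²`, these squares,
for `q = (j, i)` in `Fin n × Fin n`, are the `1/√R`-squares tiling `[0,1]²`. -/
def square {n : ℕ} (q : Fin n × Fin n) : Set (ℝ × ℝ) :=
  Set.Icc ((q.1 : ℝ) / n) (((q.1 : ℝ) + 1) / n) ×ˢ Set.Icc ((q.2 : ℝ) / n) (((q.2 : ℝ) + 1) / n)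

/-- The union of a collection of `1/n`-squares. -/
def ensemble {n : ℕ} (A : Finset (Fin n × Fin n)) : Set (ℝ × ℝ) := ⋃ q ∈ A, square q

/-- The collections `S₁, …, S_M` form a partition of all the `1/n`-squares, and each of them
consists of `R/M` squares, where `R = n²`. -/
structure IsClassSystem {n M : ℕ} (S : Fin M → Finset (Fin n × Fin n)) : Prop where
  disjoint : ∀ k l, k ≠ l → Disjoint (S k) (S l)
  covers : ∀ q, ∃ k, q ∈ S k
  card_eq : ∀ k, (S k).card = n ^ 2 / M

open Classical in
/-- The (unordered) partitions of the set of all `1/n`-squares into cells, each of which has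
exactly one element from each of the collections `S₁, …, S_M`. -/
def transversalPartitions {n M : ℕ} (S : Fin M → Finset (Fin n × Fin n)) :
    Finset (Finpartition (Finset.univ : Finset (Fin n × Fin n))) :=
  Finset.univ.filter fun P => ∀ A ∈ P.parts, ∀ k, (A ∩ S k).card = 1

/-- The weight `w_B`, for the ball `B` with centre `c` and radius `r`. -/
def ballWeight (c : EuclideanSpace ℝ (Fin 3)) (r : ℝ) (x : EuclideanSpace ℝ (Fin 3)) : ℝ :=
  ((1 + ‖x - c‖ / r) ^ 100)⁻¹

/-- For `M ∼ R^(1-γ)`, where `R = n²` and `M` divides `R`, the `L³` large ensemble decoupling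
holds on average over the partitions whose cells have one square from each class `S n M k`. -/
def AveragedDecoupling (S : ∀ n M : ℕ, Fin M → Finset (Fin n × Fin n)) (γ : ℝ) : Prop :=
  ∀ ε : ℝ, 0 < ε → ∃ C : ℝ, ∀ n M : ℕ, ∀ R : ℝ, 1 ≤ n → R = (n : ℝ) ^ 2 → M ∣ n ^ 2 →
    R ^ (1 - γ) / 2 ≤ M → M ≤ 2 * R ^ (1 - γ) →
    ∀ F : ℝ × ℝ → ℂ, MemLp F ⊤ (volume.restrict unitSquare) →
    ∀ c : EuclideanSpace ℝ (Fin 3),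
      ∫ x in Metric.ball c R, ‖extensionOp unitSquare F x‖ ^ 3 ≤
        C * R ^ ε * ((1 / ((transversalPartitions (S n M)).card : ℝ)) *
          ∑ P ∈ transversalPartitions (S n M), (R / M) ^ (1 / 2 : ℝ) *
            ∑ A ∈ P.parts, ∫ x, ‖extensionOp (ensemble A) F x‖ ^ 3 * ballWeight c R x)

/-- The Restriction conjecture for the paraboloid, in its local form: the integral of `|EF|³` over
any ball of radius `√R` is at most `C_ε R^ε ‖F‖_∞³`. -/
def RestrictionConjecture : Prop :=
  ∀ ε : ℝ, 0 < ε → ∃ C : ℝ, ∀ R : ℝ, 1 ≤ R →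
    ∀ F : ℝ × ℝ → ℂ, MemLp F ⊤ (volume.restrict unitSquare) →
    ∀ c : EuclideanSpace ℝ (Fin 3),
      ∫ x in Metric.ball c (Real.sqrt R), ‖extensionOp unitSquare F x‖ ^ 3 ≤
        C * R ^ ε * (eLpNorm F ⊤ (volume.restrict unitSquare)).toReal ^ 3

end

end LargeEnsemble

namespace LargeEnsemble

open MeasureTheory
open scoped ENNReal

noncomputable section

/-! The averaged inequality is tested only on functions $F=\sum_q a_q1_q$ constant on the
$1/n$-squares. Put $L=R/M\sim R^\gamma$. A cell of a random transversal partition is a uniformly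
random transversal, so for fixed $x$ the value $E_{P_j}F(x)$ is a sum of $M$ independent variables,
one per class, with mean $EF(x)/L$. A third-moment bound for such sums (`sum_pi_norm_cube_le'`,
`average_transversalPartitions_le`) majorises the averaged right side by
$L^{1/2}\big(L^{-2}|EF|^3+L\,(\sum_q|E_qF|^2)^{3/2}\big)$, up to constants.

With the loss $R^\gamma$ in the decoupling inequality, the first term carries $R^\gamma
L^{-3/2}\lesssim R^{-\gamma/2}$ and is absorbed on the left for large $R$. What remains is a reverse
square function estimate with loss $R^{O(\gamma)}$ (`lintegral_ball_squareSum_le`).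

For $|a_q|\le1$ the square function is at most that of $a=1$, whose wave packets all pass through
the origin. It factors into two planar square functions, which are computed by the first derivative
test. The integral of its cube is logarithmic in $R$ (`lintegral_squareFunction_le`), so no Kakeya
information is needed.

Finally, on a ball of radius $n/100\sim\sqrt R$ the waves of one square barely differ from each
other. Hence exponential sums with one frequency per square are controlled by functions constant on
squares (`waveSup_le`), and a general $EF$ is an integral of such exponential sums over the common
shift of the frequencies (`lintegral_extensionOp_le`). As $\gamma$ may be taken arbitrarily small,
the loss is $R^\epsilon$. -/

/-! ### Moments of sums of independent variables -/

/-- The term linear in `y` is kept exact, because it vanishes when summed over a centred variable.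
The others are bounded by Cauchy–Schwarz and $2(r-w)^2\ge0$, where $r$ is the inner product and
$w=|y|^2$. -/
lemma norm_add_pow_four_le (s y : ℂ) {b : ℝ} (hy : ‖y‖ ^ 2 ≤ b) :
    ‖s + y‖ ^ 4 ≤ ‖s‖ ^ 4 + 4 * ‖s‖ ^ 2 * inner ℝ s y + 8 * ‖s‖ ^ 2 * b + 3 * b ^ 2 := by
  have h1 : ‖s + y‖ ^ 4 = (‖s‖ ^ 2 + 2 * inner ℝ s y + ‖y‖ ^ 2) ^ 2 := by
    rw [← norm_add_sq_real]; ring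
  have h2 : (inner ℝ s y) ^ 2 ≤ ‖s‖ ^ 2 * ‖y‖ ^ 2 := by
    rw [← mul_pow]
    exact sq_le_sq' (neg_le_of_abs_le (abs_real_inner_le_norm s y))
      (le_of_abs_le (abs_real_inner_le_norm s y))
  rw [h1]
  set r := inner ℝ s y
  have hp : 0 ≤ ‖s‖ ^ 2 := by positivity
  have hw : 0 ≤ ‖y‖ ^ 2 := by positivity
  have h4 : ‖s‖ ^ 4 = (‖s‖ ^ 2) ^ 2 := by ring
  rw [h4]
  generalize ‖s‖ ^ 2 = p at *
  generalize ‖y‖ ^ 2 = w at *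
  nlinarith [sq_nonneg (r - w), mul_le_mul_of_nonneg_left hy hp, mul_le_mul hy hy hw (hw.trans hy)]

lemma sum_fin_succ_pi {m L : ℕ} (y : Fin (m + 1) → Fin L → ℂ) (g : ℂ → ℝ) :
    ∑ f : Fin (m + 1) → Fin L, g (∑ k, y k (f k)) =
      ∑ f : Fin m → Fin L, ∑ i, g ((∑ k, y k.succ (f k)) + y 0 i) := by
  rw [← (Fin.consEquiv fun _ => Fin L).sum_comp, Fintype.sum_prod_type, Finset.sum_comm]
  simp [Fin.consEquiv, Fin.sum_univ_succ, add_comm]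

/-- Orthogonality of independent centred variables: when one more variable is added, its cross term
with the others sums to zero. Expectations are written as sums over all choices `f`, hence the
factor $L^m$. -/
lemma sum_pi_norm_sq_le {L : ℕ} : ∀ {m : ℕ} (y : Fin m → Fin L → ℂ) (b : Fin m → ℝ),
    (∀ k i, ‖y k i‖ ^ 2 ≤ b k) → (∀ k, ∑ i, y k i = 0) →
    ∑ f : Fin m → Fin L, ‖∑ k, y k (f k)‖ ^ 2 ≤ L ^ m * ∑ k, b k
  | 0, y, b, _, _ => by simp
  | m + 1, y, b, hb, hy => by
    have ih := sum_pi_norm_sq_le (fun k => y k.succ) (fun k => b k.succ)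
      (fun k => hb k.succ) (fun k => hy k.succ)
    rw [sum_fin_succ_pi y (fun z => ‖z‖ ^ 2)]
    have step : ∀ s : ℂ, ∑ i, ‖s + y 0 i‖ ^ 2 ≤ L * ‖s‖ ^ 2 + L * b 0 := by
      intro s
      have : ∀ i, ‖s + y 0 i‖ ^ 2 ≤ ‖s‖ ^ 2 + 2 * inner ℝ s (y 0 i) + b 0 := by
        intro i; rw [norm_add_sq_real]; linarith [hb 0 i]
      refine (Finset.sum_le_sum fun i _ => this i).trans_eq ?_
      rw [Finset.sum_add_distrib, Finset.sum_add_distrib, ← Finset.mul_sum, ← inner_sum, hy 0]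
      simp
    refine (Finset.sum_le_sum fun f _ => step _).trans ?_
    rw [Finset.sum_add_distrib, ← Finset.mul_sum, Fin.sum_univ_succ]
    have hL : (0 : ℝ) ≤ L := by positivity
    calc _ ≤ (L : ℝ) * (L ^ m * ∑ k : Fin m, b k.succ) + ∑ f : Fin m → Fin L, (L : ℝ) * b 0 :=
          add_le_add (mul_le_mul_of_nonneg_left ih hL) le_rfl
      _ = _ := by simp; ring

/-- The same induction, with the second moment entering through the mixed term. It closes because
$8B^2+8b_0B+3b_0^2\le8(B+b_0)^2$. -/
lemma sum_pi_norm_pow_four_le {L : ℕ} : ∀ {m : ℕ} (y : Fin m → Fin L → ℂ) (b : Fin m → ℝ),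
    (∀ k, 0 ≤ b k) → (∀ k i, ‖y k i‖ ^ 2 ≤ b k) → (∀ k, ∑ i, y k i = 0) →
    ∑ f : Fin m → Fin L, ‖∑ k, y k (f k)‖ ^ 4 ≤ L ^ m * (8 * (∑ k, b k) ^ 2)
  | 0, y, b, _, _, _ => by simp
  | m + 1, y, b, hb0, hb, hy => by
    have ih := sum_pi_norm_pow_four_le (fun k => y k.succ) (fun k => b k.succ)
      (fun k => hb0 k.succ) (fun k => hb k.succ) (fun k => hy k.succ)
    have ih2 := sum_pi_norm_sq_le (fun k => y k.succ) (fun k => b k.succ)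
      (fun k => hb k.succ) (fun k => hy k.succ)
    rw [sum_fin_succ_pi y (fun z => ‖z‖ ^ 4)]
    have step : ∀ s : ℂ, ∑ i, ‖s + y 0 i‖ ^ 4 ≤
        L * ‖s‖ ^ 4 + (L * (8 * b 0)) * ‖s‖ ^ 2 + L * (3 * b 0 ^ 2) := by
      intro s
      refine (Finset.sum_le_sum fun i _ => norm_add_pow_four_le s (y 0 i) (hb 0 i)).trans_eq ?_
      rw [Finset.sum_add_distrib, Finset.sum_add_distrib, Finset.sum_add_distrib,
        ← Finset.mul_sum, ← inner_sum, hy 0]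
      simp; ring
    refine (Finset.sum_le_sum fun f _ => step _).trans ?_
    rw [Finset.sum_add_distrib, Finset.sum_add_distrib, ← Finset.mul_sum, ← Finset.mul_sum,
      Fin.sum_univ_succ]
    have hL : (0 : ℝ) ≤ L := by positivity
    have h0 := hb0 0
    set B := ∑ k : Fin m, b k.succ
    calc _ ≤ (L : ℝ) * (L ^ m * (8 * B ^ 2)) + (L * (8 * b 0)) * (L ^ m * B) +
          ∑ f : Fin m → Fin L, (L : ℝ) * (3 * b 0 ^ 2) := by gcongr
      _ = L ^ (m + 1) * (8 * B ^ 2 + 8 * b 0 * B + 3 * b 0 ^ 2) := by simp; ring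
      _ ≤ _ := by
        have hB : 0 ≤ B := Finset.sum_nonneg fun k _ => hb0 k.succ
        have : 0 ≤ b 0 * B := mul_nonneg h0 hB
        gcongr
        nlinarith [sq_nonneg (b 0)]

/-- The third moment of a sum of independent centred bounded variables. -/
lemma sum_pi_norm_cube_le {L m : ℕ} (y : Fin m → Fin L → ℂ) (b : Fin m → ℝ)
    (hb0 : ∀ k, 0 ≤ b k) (hb : ∀ k i, ‖y k i‖ ^ 2 ≤ b k) (hy : ∀ k, ∑ i, y k i = 0) :
    ∑ f : Fin m → Fin L, ‖∑ k, y k (f k)‖ ^ 3 ≤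
      L ^ m * (3 * ((∑ k, b k) * √(∑ k, b k))) := by
  have h2 := sum_pi_norm_sq_le y b hb hy
  have h4 := sum_pi_norm_pow_four_le y b hb0 hb hy
  -- The third moment is interpolated between the second and the fourth; the constant is
  -- $\sqrt8\le3$.
  have cs := Finset.sum_mul_sq_le_sq_mul_sq Finset.univ
    (fun f : Fin m → Fin L => ‖∑ k, y k (f k)‖) (fun f => ‖∑ k, y k (f k)‖ ^ 2)
  have e1 : ∀ f : Fin m → Fin L, ‖∑ k, y k (f k)‖ * ‖∑ k, y k (f k)‖ ^ 2 =
      ‖∑ k, y k (f k)‖ ^ 3 := fun f => by ring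
  have e2 : ∀ f : Fin m → Fin L, (‖∑ k, y k (f k)‖ ^ 2) ^ 2 = ‖∑ k, y k (f k)‖ ^ 4 :=
    fun f => by ring
  simp only [e1, e2] at cs
  have hB : 0 ≤ ∑ k, b k := Finset.sum_nonneg fun k _ => hb0 k
  set B := ∑ k, b k
  have hs : √B ^ 2 = B := Real.sq_sqrt hB
  refine abs_le_of_sq_le_sq' ?_ (by positivity) |>.2
  calc _ ≤ _ := cs
    _ ≤ (L ^ m * B) * (L ^ m * (8 * B ^ 2)) := by
        apply mul_le_mul h2 h4 (by positivity) (by positivity)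
    _ ≤ (L ^ m * (3 * (B * √B))) ^ 2 := by
        have : (L ^ m * (3 * (B * √B))) ^ 2 = (L ^ m) ^ 2 * (9 * (B ^ 3)) := by
          rw [mul_pow, mul_pow, mul_pow, hs]; ring
        rw [this]
        have : ((L : ℝ) ^ m * B) * (L ^ m * (8 * B ^ 2)) = (L ^ m) ^ 2 * (8 * B ^ 3) := by ring
        rw [this]
        gcongr
        norm_num

lemma add_cube_le {a b : ℝ} (ha : 0 ≤ a) (hb : 0 ≤ b) : (a + b) ^ 3 ≤ 4 * a ^ 3 + 4 * b ^ 3 := by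
  nlinarith [mul_nonneg (add_nonneg ha hb) (sq_nonneg (a - b))]

/-- The third moment of a sum of independent variables, each of them uniform on `L` values. -/
lemma sum_pi_norm_cube_le' {L m : ℕ} (hL : 0 < L) (z : Fin m → Fin L → ℂ) :
    ∑ f : Fin m → Fin L, ‖∑ k, z k (f k)‖ ^ 3 ≤
      L ^ m * (4 * (‖∑ k, ∑ i, z k i‖ / L) ^ 3 +
        96 * ((∑ k, ∑ i, ‖z k i‖ ^ 2) * √(∑ k, ∑ i, ‖z k i‖ ^ 2))) := by
  have hL' : (0 : ℝ) < L := by exact_mod_cast hL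
  have hLc : (L : ℂ) ≠ 0 := by exact_mod_cast hL.ne'
  -- Each variable is split into its mean and a centred part. The means add up to the full sum
  -- divided by $L$.
  set μ : Fin m → ℂ := fun k => (∑ i, z k i) / L with hμ
  set y : Fin m → Fin L → ℂ := fun k i => z k i - μ k with hy
  -- Both the variance and the size of the $k$-th variable are controlled by the sum of squares over
  -- all its values. This wastes a power of $L$, which is harmless. Since $(4V)^{3/2}=8V^{3/2}$, the
  -- constant 96 is $4\cdot3\cdot8$.
  set v : Fin m → ℝ := fun k => ∑ i, ‖z k i‖ ^ 2 with hv
  have hy0 : ∀ k, ∑ i, y k i = 0 := by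
    intro k
    simp only [hy, hμ, Finset.sum_sub_distrib, Finset.sum_const, Finset.card_univ,
      Fintype.card_fin, nsmul_eq_mul]
    field_simp
    simp
  have hv0 : ∀ k, 0 ≤ v k := fun k => Finset.sum_nonneg fun i _ => by positivity
  have hz : ∀ k i, ‖z k i‖ ^ 2 ≤ v k := fun k i =>
    Finset.single_le_sum (f := fun i => ‖z k i‖ ^ 2) (fun i _ => by positivity) (Finset.mem_univ i)
  have hzs : ∀ k i, ‖z k i‖ ≤ √(v k) := fun k i => Real.le_sqrt_of_sq_le (hz k i)
  have hμs : ∀ k, ‖μ k‖ ≤ √(v k) := by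
    intro k
    rw [hμ]
    simp only [norm_div, Complex.norm_natCast]
    rw [div_le_iff₀ hL']
    refine (norm_sum_le _ _).trans ((Finset.sum_le_sum fun i _ => hzs k i).trans_eq ?_)
    simp [mul_comm]
  have hyb : ∀ k i, ‖y k i‖ ^ 2 ≤ 4 * v k := by
    intro k i
    have h1 : ‖y k i‖ ≤ 2 * √(v k) := (norm_sub_le _ _).trans (by linarith [hzs k i, hμs k])
    calc ‖y k i‖ ^ 2 ≤ (2 * √(v k)) ^ 2 := by gcongr
      _ = 4 * v k := by rw [mul_pow, Real.sq_sqrt (hv0 k)]; norm_num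
  have h3 := sum_pi_norm_cube_le y (fun k => 4 * v k) (fun k => by linarith [hv0 k]) hyb hy0
  rw [← Finset.mul_sum] at h3
  set V := ∑ k, v k with hV
  have hs4 : √(4 * V) = 2 * √V := by
    rw [Real.sqrt_mul (by norm_num), show (4 : ℝ) = 2 ^ 2 by norm_num, Real.sqrt_sq (by norm_num)]
  rw [hs4] at h3
  have hm : ‖∑ k, μ k‖ = ‖∑ k, ∑ i, z k i‖ / L := by
    simp only [hμ, ← Finset.sum_div, norm_div, Complex.norm_natCast]
  have hdec : ∀ f : Fin m → Fin L, ‖∑ k, z k (f k)‖ ^ 3 ≤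
      4 * (‖∑ k, ∑ i, z k i‖ / L) ^ 3 + 4 * ‖∑ k, y k (f k)‖ ^ 3 := by
    intro f
    have : ∑ k, z k (f k) = (∑ k, μ k) + ∑ k, y k (f k) := by
      rw [← Finset.sum_add_distrib]; simp [hy]
    rw [this, ← hm]
    refine le_trans ?_ (add_cube_le (norm_nonneg _) (norm_nonneg _))
    gcongr
    exact norm_add_le _ _
  refine (Finset.sum_le_sum fun f _ => hdec f).trans ?_
  rw [Finset.sum_add_distrib, ← Finset.mul_sum (f := fun f : Fin m → Fin L => ‖∑ k, y k (f k)‖ ^ 3)]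
  simp only [Finset.sum_const, Finset.card_univ, Fintype.card_pi, Fintype.card_fin,
    Finset.prod_const, nsmul_eq_mul]
  push_cast
  nlinarith [h3]

/-! ### Averaging over transversal partitions -/

section Transversal

variable {κ ι α : Type*} [Fintype κ] [DecidableEq α]

/-- The transversal with one element from each fibre of `E.symm · |>.1`, selected by `f`. -/
def graphSet (E : κ × ι ≃ α) (f : κ → ι) : Finset α := Finset.univ.image fun k => E (k, f k)

lemma mem_graphSet (E : κ × ι ≃ α) (f : κ → ι) (q : α) :
    q ∈ graphSet E f ↔ f (E.symm q).1 = (E.symm q).2 := by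
  simp only [graphSet, Finset.mem_image, Finset.mem_univ, true_and]
  constructor
  · rintro ⟨k, rfl⟩; simp
  · intro h
    exact ⟨(E.symm q).1, by rw [h]; simp⟩

lemma graphSet_injective (E : κ × ι ≃ α) : Function.Injective (graphSet E) := by
  intro f g h
  funext k
  have : E (k, f k) ∈ graphSet E g := by rw [← h, mem_graphSet]; simp
  rw [mem_graphSet] at this
  simpa using this.symm

lemma sum_graphSet (E : κ × ι ≃ α) (f : κ → ι) (z : α → ℂ) :
    ∑ q ∈ graphSet E f, z q = ∑ k, z (E (k, f k)) := by
  rw [graphSet, Finset.sum_image]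
  intro a _ b _ h
  simpa using congrArg Prod.fst (E.injective h)

lemma exists_eq_graphSet (E : κ × ι ≃ α) (S : κ → Finset α)
    (hE : ∀ k q, q ∈ S k ↔ (E.symm q).1 = k) (A : Finset α) (hA : ∀ k, (A ∩ S k).card = 1) :
    ∃ f, A = graphSet E f := by
  choose a ha using fun k => Finset.card_eq_one.mp (hA k)
  refine ⟨fun k => (E.symm (a k)).2, ?_⟩
  have hk : ∀ k, a k ∈ A ∧ (E.symm (a k)).1 = k := by
    intro k
    have : a k ∈ A ∩ S k := by rw [ha]; simp
    rw [Finset.mem_inter, hE] at this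
    exact this
  ext q
  rw [mem_graphSet]
  constructor
  · intro hq
    have : q ∈ A ∩ S (E.symm q).1 := by
      rw [Finset.mem_inter, hE]; exact ⟨hq, rfl⟩
    rw [ha, Finset.mem_singleton] at this
    rw [← this]
  · intro hq
    have : E.symm (a (E.symm q).1) = E.symm q := Prod.ext (hk _).2 hq
    rw [← E.symm.injective this]
    exact (hk _).1

variable [Fintype α]

/-- The order automorphism of the finsets of `α` induced by a permutation of `α`. -/
def finsetOrderIso (τ : Equiv.Perm α) : Finset α ≃o Finset α where
  toEquiv := τ.finsetCongr
  map_rel_iff' := by simp [Equiv.finsetCongr_apply]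

/-- The image of a partition under a permutation. -/
def permPartition (τ : Equiv.Perm α) (P : Finpartition (Finset.univ : Finset α)) :
    Finpartition (Finset.univ : Finset α) :=
  (P.map (finsetOrderIso τ)).copy (by
    simp only [finsetOrderIso, RelIso.coe_fn_mk, Equiv.finsetCongr_apply]
    exact Finset.map_univ_equiv τ)

lemma mem_permPartition (τ : Equiv.Perm α) (P : Finpartition (Finset.univ : Finset α))
    (A : Finset α) : A ∈ (permPartition τ P).parts ↔ A.map τ.symm.toEmbedding ∈ P.parts := by
  simp only [permPartition, Finpartition.copy, Finpartition.parts_map, Finset.mem_map_equiv]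
  rfl

lemma permPartition_injective (τ : Equiv.Perm α) :
    Function.Injective (permPartition τ) := by
  intro P Q h
  ext A
  have := mem_permPartition τ P (A.map τ.toEmbedding)
  have h2 := mem_permPartition τ Q (A.map τ.toEmbedding)
  rw [h] at this
  have e : (A.map τ.toEmbedding).map τ.symm.toEmbedding = A := by
    ext; simp
  rw [e] at this h2
  exact this.symm.trans h2

open Classical in
/-- The partitions of `α` into transversals of the system `S`. -/
def transversals (S : κ → Finset α) : Finset (Finpartition (Finset.univ : Finset α)) :=
  Finset.univ.filter fun P => ∀ A ∈ P.parts, ∀ k, (A ∩ S k).card = 1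

-- Permutations preserving every class act on the transversal partitions, and they act transitively
-- on transversals. Exchanging `f k` and `g k` in each class therefore injects the partitions
-- containing one graph into those containing the other.
open Classical in
lemma card_filter_graphSet_le (E : κ × ι ≃ α) (S : κ → Finset α)
    (hE : ∀ k q, q ∈ S k ↔ (E.symm q).1 = k) (f g : κ → ι) :
    ((transversals S).filter fun P => graphSet E f ∈ P.parts).card ≤
      ((transversals S).filter fun P => graphSet E g ∈ P.parts).card := by
  set σ : Equiv.Perm (κ × ι) := Equiv.prodShear (Equiv.refl κ) fun k => Equiv.swap (f k) (g k)
    with hσ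
  set τ : Equiv.Perm α := (E.symm.trans σ).trans E with hτ
  have hτ1 : ∀ q, (E.symm (τ q)).1 = (E.symm q).1 := by
    intro q; simp [hτ, hσ]
  refine Finset.card_le_card_of_injOn (permPartition τ) ?_ (permPartition_injective τ).injOn
  intro P hP
  simp only [transversals, Finset.mem_filter, Finset.mem_univ, true_and, Finset.coe_filter,
    Set.mem_ofPred_eq] at hP ⊢
  refine ⟨fun A hA k => ?_, ?_⟩
  · rw [mem_permPartition] at hA
    rw [← hP.1 _ hA k]
    refine (Finset.card_map τ.toEmbedding).symm.trans ?_ |>.symm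
    congr 1
    ext q
    simp only [Finset.mem_map_equiv, Finset.mem_inter, Equiv.symm_symm, Equiv.apply_symm_apply, hE]
    rw [← hτ1 (τ.symm q), Equiv.apply_symm_apply]
  · rw [mem_permPartition]
    convert hP.2
    ext q
    simp only [Finset.mem_map_equiv, Equiv.symm_symm, mem_graphSet, hτ1]
    simp only [hτ, hσ, Equiv.trans_apply, Equiv.symm_apply_apply, Equiv.prodShear_apply,
      Equiv.refl_apply]
    rw [eq_comm, ← Equiv.eq_symm_apply, Equiv.symm_swap, Equiv.swap_apply_right, eq_comm]

open Classical in
/-- Averaging over the cells of all transversal partitions is averaging over all transversals. -/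
lemma sum_transversals [Fintype ι] [DecidableEq κ] (E : κ × ι ≃ α) (S : κ → Finset α)
    (hE : ∀ k q, q ∈ S k ↔ (E.symm q).1 = k) [Nonempty κ] (φ : Finset α → ℝ) :
    (Fintype.card ι : ℝ) ^ Fintype.card κ * ∑ P ∈ transversals S, ∑ A ∈ P.parts, φ A =
      (transversals S).card * (Fintype.card ι * ∑ f : κ → ι, φ (graphSet E f)) := by
  have swap : ∀ ψ : Finset α → ℝ, ∑ P ∈ transversals S, ∑ A ∈ P.parts, ψ A =
      ∑ f : κ → ι, ((transversals S).filter fun P => graphSet E f ∈ P.parts).card *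
        ψ (graphSet E f) := by
    intro ψ
    have : ∀ P ∈ transversals S, ∑ A ∈ P.parts, ψ A =
        ∑ f : κ → ι, if graphSet E f ∈ P.parts then ψ (graphSet E f) else 0 := by
      intro P hP
      simp only [transversals, Finset.mem_filter, Finset.mem_univ, true_and] at hP
      rw [← Finset.sum_filter]
      rw [← Finset.sum_image (f := ψ) (g := graphSet E) (graphSet_injective E).injOn]
      congr 1
      ext A
      simp only [Finset.mem_image, Finset.mem_filter, Finset.mem_univ, true_and]
      constructor
      · intro hA
        obtain ⟨f, rfl⟩ := exists_eq_graphSet E S hE A (hP A hA)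
        exact ⟨f, hA, rfl⟩
      · rintro ⟨f, hf, rfl⟩; exact hf
    rw [Finset.sum_congr rfl this, Finset.sum_comm]
    refine Finset.sum_congr rfl fun f _ => ?_
    rw [← Finset.sum_filter, Finset.sum_const, nsmul_eq_mul]
  -- By symmetry, every transversal lies in the same number $N$ of partitions.
  have hconst : ∃ N : ℕ, ∀ f : κ → ι,
      ((transversals S).filter fun P => graphSet E f ∈ P.parts).card = N := by
    by_cases h : Nonempty (κ → ι)
    · obtain ⟨g⟩ := h
      exact ⟨_, fun f => le_antisymm (card_filter_graphSet_le E S hE f g)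
        (card_filter_graphSet_le E S hE g f)⟩
    · exact ⟨0, fun f => (h ⟨f⟩).elim⟩
  obtain ⟨N, hN⟩ := hconst
  have hparts : ∀ P ∈ transversals S, P.parts.card = Fintype.card ι := by
    intro P hP
    simp only [transversals, Finset.mem_filter, Finset.mem_univ, true_and] at hP
    have h1 := P.sum_card_parts
    have h2 : ∀ A ∈ P.parts, A.card = Fintype.card κ := by
      intro A hA
      obtain ⟨f, rfl⟩ := exists_eq_graphSet E S hE A (hP A hA)
      rw [graphSet, Finset.card_image_of_injective, Finset.card_univ]
      intro a b h
      simpa using congrArg Prod.fst (E.injective h)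
    rw [Finset.sum_congr rfl h2, Finset.sum_const, smul_eq_mul, Finset.card_univ,
      ← Fintype.card_congr E, Fintype.card_prod, mul_comm] at h1
    exact Nat.eq_of_mul_eq_mul_left Fintype.card_pos h1
  -- Double counting with the constant function determines $N$, since every partition has as many
  -- cells as a class has elements.
  have hcount := swap fun _ => 1
  simp only [hN, mul_one, Finset.sum_const, nsmul_eq_mul, Finset.card_univ, Fintype.card_fun] at hcount
  rw [Finset.sum_congr rfl fun P hP => by rw [hparts P hP], Finset.sum_const, nsmul_eq_mul] at hcount
  rw [swap φ]
  simp only [hN]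
  rw [← Finset.mul_sum, ← mul_assoc, ← mul_assoc, hcount]
  push_cast
  ring

end Transversal

/-- Coordinates (class, position in the class). In them transversals are graphs of functions, that
is, independent choices of one position per class. -/
lemma exists_equiv_of_isClassSystem {n M : ℕ} {S : Fin M → Finset (Fin n × Fin n)}
    (hS : IsClassSystem S) :
    ∃ E : Fin M × Fin (n ^ 2 / M) ≃ Fin n × Fin n, ∀ k q, q ∈ S k ↔ (E.symm q).1 = k := by
  set e := fun k => (S k).equivFinOfCardEq (hS.card_eq k)
  have hu : ∀ k l q, q ∈ S k → q ∈ S l → k = l := by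
    intro k l q h1 h2
    by_contra h
    exact Finset.disjoint_left.mp (hS.disjoint k l h) h1 h2
  set F : Fin M × Fin (n ^ 2 / M) → Fin n × Fin n := fun p => ((e p.1).symm p.2 : Fin n × Fin n)
    with hF
  have hFm : ∀ p, F p ∈ S p.1 := fun p => ((e p.1).symm p.2).2
  have hb : Function.Bijective F := by
    constructor
    · rintro ⟨k, i⟩ ⟨l, j⟩ h
      have h1 := hFm (k, i)
      have h2 := hFm (l, j)
      rw [← h] at h2
      obtain rfl : k = l := hu _ _ _ h1 h2
      have : (e k).symm i = (e k).symm j := Subtype.ext h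
      rw [(e k).symm.injective this]
    · intro q
      obtain ⟨k, hk⟩ := hS.covers q
      exact ⟨(k, e k ⟨q, hk⟩), by simp [hF]⟩
  refine ⟨Equiv.ofBijective F hb, fun k q => ?_⟩
  have := hFm ((Equiv.ofBijective F hb).symm q)
  have hq : F ((Equiv.ofBijective F hb).symm q) = q := (Equiv.ofBijective F hb).apply_symm_apply q
  rw [hq] at this
  constructor
  · intro h; exact hu _ _ _ this h
  · rintro rfl; exact this

/-- The average over the transversal partitions, in terms of the full sum and of the square
function. -/
lemma average_transversalPartitions_le {n M : ℕ} (hn : 1 ≤ n) (hM : M ∣ n ^ 2)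
    {S : Fin M → Finset (Fin n × Fin n)} (hS : IsClassSystem S) (z : Fin n × Fin n → ℂ)
    {L : ℝ} (hL : L = (n : ℝ) ^ 2 / M) :
    1 / ((transversalPartitions S).card : ℝ) *
        ∑ P ∈ transversalPartitions S, ∑ A ∈ P.parts, ‖∑ q ∈ A, z q‖ ^ 3 ≤
      4 * L⁻¹ ^ 2 * ‖∑ q, z q‖ ^ 3 + 96 * L * ((∑ q, ‖z q‖ ^ 2) * √(∑ q, ‖z q‖ ^ 2)) := by
  have hM0 : 0 < M := Nat.pos_of_dvd_of_pos hM (by positivity)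
  have : Nonempty (Fin M) := ⟨⟨0, hM0⟩⟩
  obtain ⟨E, hE⟩ := exists_equiv_of_isClassSystem hS
  have hT : transversalPartitions S = transversals S := by
    ext P; simp [transversalPartitions, transversals]
  have hLN : ((n ^ 2 / M : ℕ) : ℝ) = L := by
    rw [hL, Nat.cast_div hM (by positivity)]; push_cast; rfl
  have hL0 : 0 < n ^ 2 / M := Nat.div_pos (Nat.le_of_dvd (by positivity) hM) hM0
  have hLpos : 0 < L := by rw [← hLN]; exact_mod_cast hL0
  have key := sum_transversals E S hE fun A => ‖∑ q ∈ A, z q‖ ^ 3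
  have hm := sum_pi_norm_cube_le' hL0 fun k i => z (E (k, i))
  simp only [sum_graphSet, Fintype.card_fin, hLN] at key
  rw [hLN] at hm
  have e1 : ∑ k, ∑ i, z (E (k, i)) = ∑ q, z q := by
    rw [← E.sum_comp, Fintype.sum_prod_type]
  have e2 : ∑ k, ∑ i, ‖z (E (k, i))‖ ^ 2 = ∑ q, ‖z q‖ ^ 2 := by
    rw [← E.sum_comp, Fintype.sum_prod_type]
  rw [e1, e2] at hm
  rw [hT]
  set X := ∑ P ∈ transversals S, ∑ A ∈ P.parts, ‖∑ q ∈ A, z q‖ ^ 3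
  set N : ℝ := ((transversals S).card : ℝ)
  have hrhs : 0 ≤ 4 * L⁻¹ ^ 2 * ‖∑ q, z q‖ ^ 3 +
      96 * L * ((∑ q, ‖z q‖ ^ 2) * √(∑ q, ‖z q‖ ^ 2)) := by positivity
  -- The existence of a transversal partition need not be proved: with none, the average is 0 by the
  -- convention $1/0=0$.
  rcases eq_or_ne N 0 with hN | hN
  · rw [hN]; simpa using hrhs
  have hNpos : 0 < N := lt_of_le_of_ne (Nat.cast_nonneg _) hN.symm
  have hLM : 0 < L ^ M := by positivity
  rw [one_div, inv_mul_le_iff₀ hNpos]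
  refine le_of_mul_le_mul_left ?_ hLM
  rw [key]
  refine (mul_le_mul_of_nonneg_left (mul_le_mul_of_nonneg_left hm hLpos.le) hNpos.le).trans_eq ?_
  field_simp

/-! ### Plane waves and functions constant on squares -/

/-- The plane wave `e((ξ, |ξ|²) · x)`. -/
def wave (ξ : ℝ × ℝ) (x : EuclideanSpace ℝ (Fin 3)) : ℂ :=
  Complex.exp (2 * Real.pi * phase ξ x * Complex.I)

lemma norm_wave (ξ : ℝ × ℝ) (x : EuclideanSpace ℝ (Fin 3)) : ‖wave ξ x‖ = 1 := by
  have : (2 * Real.pi * phase ξ x * Complex.I : ℂ) = ((2 * Real.pi * phase ξ x : ℝ) : ℂ) * Complex.I := by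
    push_cast; ring
  rw [wave, this, Complex.norm_exp_ofReal_mul_I]

@[fun_prop]
lemma continuous_wave : Continuous fun p : (ℝ × ℝ) × EuclideanSpace ℝ (Fin 3) => wave p.1 p.2 := by
  unfold wave phase
  fun_prop

lemma wave_add (ξ : ℝ × ℝ) (x y : EuclideanSpace ℝ (Fin 3)) :
    wave ξ (x + y) = wave ξ x * wave ξ y := by
  rw [wave, wave, wave, ← Complex.exp_add]
  congr 1
  simp only [phase, PiLp.add_apply]
  push_cast
  ring

/-- The half-open square with lower left corner `(j/n, i/n)` and side `1/n`. -/
def cell {n : ℕ} (q : Fin n × Fin n) : Set (ℝ × ℝ) :=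
  Set.Ico ((q.1 : ℝ) / n) (((q.1 : ℝ) + 1) / n) ×ˢ Set.Ico ((q.2 : ℝ) / n) (((q.2 : ℝ) + 1) / n)

lemma measurableSet_cell {n : ℕ} (q : Fin n × Fin n) : MeasurableSet (cell q) :=
  measurableSet_Ico.prod measurableSet_Ico

lemma volume_real_cell {n : ℕ} (q : Fin n × Fin n) :
    volume.real (cell q) = ((n : ℝ) ^ 2)⁻¹ := by
  have h : ∀ a : ℝ, (a + 1) / n - a / n = (n : ℝ)⁻¹ := fun a => by ring
  have h0 : ∀ a : ℝ, a / n ≤ (a + 1) / n := fun a => by gcongr; linarith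
  rw [cell, Measure.volume_eq_prod, measureReal_prod_prod, Real.volume_real_Ico_of_le (h0 _),
    Real.volume_real_Ico_of_le (h0 _), h, h]
  ring

/-- Half-open squares are disjoint, and replacing the closed ones by them changes no integral. -/
lemma cell_ae_eq_square {n : ℕ} (q : Fin n × Fin n) : cell q =ᵐ[volume] square q := by
  rw [Measure.volume_eq_prod]
  exact Measure.set_prod_ae_eq Ico_ae_eq_Icc Ico_ae_eq_Icc

/-- Rounding down determines the square of a point, which gives at once that the squares are
disjoint and that they cover. -/
lemma mem_cell_iff {n : ℕ} (q : Fin n × Fin n) (ξ : ℝ × ℝ) :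
    ξ ∈ cell q ↔ 0 ≤ ξ.1 ∧ 0 ≤ ξ.2 ∧ ⌊n * ξ.1⌋₊ = q.1 ∧ ⌊n * ξ.2⌋₊ = q.2 := by
  have hn : (0 : ℝ) < n := by exact_mod_cast q.1.pos
  have one : ∀ (s : ℝ) (j : ℕ), s ∈ Set.Ico ((j : ℝ) / n) (((j : ℝ) + 1) / n) ↔
      0 ≤ s ∧ ⌊n * s⌋₊ = j := by
    intro s j
    rw [Set.mem_Ico, div_le_iff₀ hn, lt_div_iff₀ hn, mul_comm s]
    constructor
    · rintro ⟨h1, h2⟩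
      have h0 : 0 ≤ n * s := (Nat.cast_nonneg j).trans h1
      exact ⟨nonneg_of_mul_nonneg_right h0 hn, (Nat.floor_eq_iff h0).mpr ⟨h1, h2⟩⟩
    · rintro ⟨h0, h⟩
      exact (Nat.floor_eq_iff (by positivity)).mp h
  rw [cell, Set.mem_prod, one, one]
  tauto

lemma pairwise_disjoint_cell {n : ℕ} :
    Pairwise (Function.onFun Disjoint (cell : Fin n × Fin n → Set (ℝ × ℝ))) := by
  intro p q hpq
  rw [Function.onFun, Set.disjoint_left]
  intro ξ hp hq
  rw [mem_cell_iff] at hp hq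
  exact hpq (Prod.ext (Fin.ext (hp.2.2.1.symm.trans hq.2.2.1))
    (Fin.ext (hp.2.2.2.symm.trans hq.2.2.2)))

lemma iUnion_cell {n : ℕ} (hn : 1 ≤ n) :
    ⋃ q : Fin n × Fin n, cell q = Set.Ico 0 1 ×ˢ Set.Ico 0 1 := by
  have hn' : (0 : ℝ) < n := by exact_mod_cast hn
  have hfl : ∀ s : ℝ, 0 ≤ s → (⌊n * s⌋₊ < n ↔ s < 1) := by
    intro s hs
    rw [Nat.floor_lt (by positivity)]
    constructor
    · intro h; by_contra h'; nlinarith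
    · intro h; nlinarith
  ext ξ
  simp only [Set.mem_iUnion, mem_cell_iff, Set.mem_prod, Set.mem_Ico]
  constructor
  · rintro ⟨q, h1, h2, h3, h4⟩
    exact ⟨⟨h1, (hfl _ h1).mp (h3 ▸ q.1.2)⟩, ⟨h2, (hfl _ h2).mp (h4 ▸ q.2.2)⟩⟩
  · rintro ⟨⟨h1, h2⟩, h3, h4⟩
    exact ⟨(⟨_, (hfl _ h1).mpr h2⟩, ⟨_, (hfl _ h3).mpr h4⟩), h1, h3, rfl, rfl⟩

lemma iUnion_cell_ae_eq_unitSquare {n : ℕ} (hn : 1 ≤ n) :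
    (⋃ q : Fin n × Fin n, cell q) =ᵐ[volume] unitSquare := by
  rw [iUnion_cell hn, Measure.volume_eq_prod]
  exact Measure.set_prod_ae_eq Ico_ae_eq_Icc Ico_ae_eq_Icc

lemma biUnion_cell_ae_eq_ensemble {n : ℕ} (A : Finset (Fin n × Fin n)) :
    (⋃ q ∈ A, cell q) =ᵐ[volume] ensemble A := by
  unfold ensemble
  exact Filter.EventuallyEq.countable_bUnion A.countable_toSet fun q _ => cell_ae_eq_square q

/-- The function equal to `a q` on each of the squares `q`. -/
def stepFun {n : ℕ} (a : Fin n × Fin n → ℂ) (ξ : ℝ × ℝ) : ℂ :=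
  ∑ q, (cell q).indicator (fun _ => a q) ξ

lemma stepFun_apply {n : ℕ} (a : Fin n × Fin n → ℂ) {q : Fin n × Fin n} {ξ : ℝ × ℝ}
    (h : ξ ∈ cell q) : stepFun a ξ = a q := by
  rw [stepFun, Finset.sum_eq_single q, Set.indicator_of_mem h]
  · intro p _ hp
    exact Set.indicator_of_notMem
      (fun h' => Set.disjoint_left.mp (pairwise_disjoint_cell hp) h' h) _
  · simp

lemma memLp_stepFun {n : ℕ} (a : Fin n × Fin n → ℂ) :
    MemLp (stepFun a) ⊤ (volume.restrict unitSquare) := by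
  have : stepFun a = ∑ q, (cell q).indicator (fun _ => a q) := by
    ext ξ; simp [stepFun]
  rw [this]
  refine memLp_finsetSum' _ fun q _ => (memLp_top_const (a q)).indicator (measurableSet_cell q)

/-- The extension operator applied to the indicator of the square `q`. -/
def squareExt {n : ℕ} (q : Fin n × Fin n) (x : EuclideanSpace ℝ (Fin 3)) : ℂ :=
  ∫ ξ in cell q, wave ξ x

lemma volume_cell_lt_top {n : ℕ} (q : Fin n × Fin n) : volume (cell q) < ⊤ := by
  rw [cell, Measure.volume_eq_prod, Measure.prod_prod, Real.volume_Ico, Real.volume_Ico]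
  exact ENNReal.mul_lt_top ENNReal.ofReal_lt_top ENNReal.ofReal_lt_top

instance {n : ℕ} (q : Fin n × Fin n) : IsFiniteMeasure (volume.restrict (cell q)) :=
  ⟨by rw [Measure.restrict_apply_univ]; exact volume_cell_lt_top q⟩

lemma integrable_wave (μ : Measure (ℝ × ℝ)) [IsFiniteMeasure μ] (x : EuclideanSpace ℝ (Fin 3)) :
    Integrable (fun ξ => wave ξ x) μ :=
  Integrable.of_bound (Continuous.aestronglyMeasurable (by fun_prop)) 1
    (Filter.Eventually.of_forall fun ξ => (norm_wave ξ x).le)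

lemma extensionOp_ensemble_stepFun {n : ℕ} (a : Fin n × Fin n → ℂ) (A : Finset (Fin n × Fin n))
    (x : EuclideanSpace ℝ (Fin 3)) :
    extensionOp (ensemble A) (stepFun a) x = ∑ q ∈ A, a q * squareExt q x := by
  have hcell : ∀ q : Fin n × Fin n, Set.EqOn (fun ξ => stepFun a ξ * wave ξ x)
      (fun ξ => a q * wave ξ x) (cell q) := by
    intro q ξ hξ
    simp only [stepFun_apply a hξ]
  have : extensionOp (ensemble A) (stepFun a) x = ∫ ξ in ensemble A, stepFun a ξ * wave ξ x := rfl
  rw [this, ← setIntegral_congr_set (biUnion_cell_ae_eq_ensemble A), integral_biUnion_finset]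
  · refine Finset.sum_congr rfl fun q _ => ?_
    rw [setIntegral_congr_fun (measurableSet_cell q) (hcell q), integral_const_mul, squareExt]
  · exact fun q _ => measurableSet_cell q
  · exact fun p _ q _ h => pairwise_disjoint_cell h
  · intro q _
    exact (integrableOn_congr_fun (hcell q) (measurableSet_cell q)).mpr
      ((integrable_wave _ x).const_mul _)

lemma extensionOp_unitSquare_stepFun {n : ℕ} (hn : 1 ≤ n) (a : Fin n × Fin n → ℂ)
    (x : EuclideanSpace ℝ (Fin 3)) :
    extensionOp unitSquare (stepFun a) x = ∑ q, a q * squareExt q x := by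
  have h1 := biUnion_cell_ae_eq_ensemble (Finset.univ : Finset (Fin n × Fin n))
  simp only [Finset.mem_univ, Set.iUnion_true] at h1
  rw [← extensionOp_ensemble_stepFun a Finset.univ, extensionOp, extensionOp]
  exact setIntegral_congr_set ((iUnion_cell_ae_eq_unitSquare hn).symm.trans h1)

lemma norm_squareExt_le {n : ℕ} (q : Fin n × Fin n) (x : EuclideanSpace ℝ (Fin 3)) :
    ‖squareExt q x‖ ≤ ((n : ℝ) ^ 2)⁻¹ := by
  have := norm_setIntegral_le_of_norm_le_const (μ := volume) (volume_cell_lt_top q)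
    (f := fun ξ => wave ξ x) (C := 1) fun ξ _ => (norm_wave ξ x).le
  rwa [one_mul, volume_real_cell] at this

@[fun_prop]
lemma continuous_squareExt {n : ℕ} (q : Fin n × Fin n) : Continuous (squareExt q) := by
  refine continuous_of_dominated (bound := fun _ => 1) (fun x => ?_) (fun x => ?_) ?_ ?_
  · exact Continuous.aestronglyMeasurable (by fun_prop)
  · exact Filter.Eventually.of_forall fun ξ => (norm_wave ξ x).le
  · exact integrable_const _
  · exact Filter.Eventually.of_forall fun ξ => by fun_prop

/-! ### Oscillatory integrals and the planar square function -/

/-- The extension operator for the parabola in the plane, for the interval `[j/n, (j+1)/n]`. -/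
def segExt (n j : ℕ) (u t : ℝ) : ℂ :=
  ∫ s in (j / n : ℝ)..((j + 1) / n : ℝ), Complex.exp (2 * Real.pi * (s * u + s ^ 2 * t : ℝ) * Complex.I)

/-- The phase is the sum of a function of $\xi_1$ and a function of $\xi_2$. -/
lemma squareExt_eq_mul {n : ℕ} (q : Fin n × Fin n) (x : EuclideanSpace ℝ (Fin 3)) :
    squareExt q x = segExt n q.1 (x 0) (x 2) * segExt n q.2 (x 1) (x 2) := by
  have h0 : ∀ a : ℝ, a / n ≤ (a + 1) / n := fun a => by gcongr; linarith
  rw [squareExt, segExt, segExt, intervalIntegral.integral_of_le (h0 _),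
    intervalIntegral.integral_of_le (h0 _), ← integral_Ico_eq_integral_Ioc,
    ← integral_Ico_eq_integral_Ioc, cell, Measure.volume_eq_prod, ← setIntegral_prod_mul]
  congr 1
  ext ξ
  rw [wave, ← Complex.exp_add]
  congr 1
  simp only [phase]
  push_cast
  ring

lemma continuous_segExt (n j : ℕ) : Continuous fun p : ℝ × ℝ => segExt n j p.1 p.2 := by
  unfold segExt
  apply intervalIntegral.continuous_parametric_intervalIntegral_of_continuous'
  fun_prop

lemma norm_segExt_le (n j : ℕ) (u t : ℝ) : ‖segExt n j u t‖ ≤ (n : ℝ)⁻¹ := by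
  have : ∀ s : ℝ, ‖Complex.exp (2 * Real.pi * (s * u + s ^ 2 * t : ℝ) * Complex.I)‖ ≤ 1 := by
    intro s
    have : (2 * Real.pi * (s * u + s ^ 2 * t : ℝ) * Complex.I : ℂ) =
      ((2 * Real.pi * (s * u + s ^ 2 * t) : ℝ) : ℂ) * Complex.I := by push_cast; ring
    rw [this, Complex.norm_exp_ofReal_mul_I]
  refine (intervalIntegral.norm_integral_le_of_norm_le_const fun s _ => this s).trans_eq ?_
  have h : ((j : ℝ) + 1) / n - j / n = (n : ℝ)⁻¹ := by ring
  rw [h, one_mul, abs_of_nonneg (by positivity)]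

/-- First derivative test for a quadratic phase. -/
lemma norm_integral_exp_quadratic_le {a b u t l : ℝ} (hab : a ≤ b) (hl : 0 < l)
    (h : ∀ s ∈ Set.Icc a b, l ≤ |u + 2 * t * s|) :
    ‖∫ s in a..b, Complex.exp (2 * Real.pi * (s * u + s ^ 2 * t : ℝ) * Complex.I)‖ ≤
      2 / l + 2 * |t| * (b - a) / l ^ 2 := by
  set E : ℝ → ℂ := fun s => Complex.exp (2 * Real.pi * (s * u + s ^ 2 * t : ℝ) * Complex.I) with hE
  set ψ : ℝ → ℂ := fun s => ((u + 2 * t * s : ℝ) : ℂ) with hψ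
  have hEn : ∀ s, ‖E s‖ = 1 := by
    intro s
    have : (2 * Real.pi * (s * u + s ^ 2 * t : ℝ) * Complex.I : ℂ) =
      ((2 * Real.pi * (s * u + s ^ 2 * t) : ℝ) : ℂ) * Complex.I := by push_cast; ring
    simp only [hE]
    rw [this, Complex.norm_exp_ofReal_mul_I]
  have hψn : ∀ s ∈ Set.Icc a b, l ≤ ‖ψ s‖ := by
    intro s hs
    simp only [hψ, Complex.norm_real, Real.norm_eq_abs]
    exact h s hs
  have hψ0 : ∀ s ∈ Set.Icc a b, ψ s ≠ 0 := fun s hs h0 => by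
    have := hψn s hs; rw [h0, norm_zero] at this; linarith
  have hEd : ∀ s, HasDerivAt E (E s * (2 * Real.pi * Complex.I * ψ s)) s := by
    intro s
    have h1 : HasDerivAt (fun s : ℝ => s * u + s ^ 2 * t) (u + 2 * t * s) s := by
      have := ((hasDerivAt_id s).mul_const u).add (((hasDerivAt_id s).pow 2).mul_const t)
      convert! this using 1
      simp; ring
    have h2 := ((h1.ofReal_comp.const_mul (2 * Real.pi : ℂ)).mul_const Complex.I).cexp
    convert! h2 using 1
    simp only [hE, hψ]
    ring
  have hψd : ∀ s, HasDerivAt ψ (2 * t) s := by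
    intro s
    have h1 : HasDerivAt (fun s : ℝ => u + 2 * t * s) (2 * t) s := by
      simpa using ((hasDerivAt_id s).const_mul (2 * t)).const_add u
    convert! h1.ofReal_comp using 1
    push_cast; rfl
  have hpi : (2 * Real.pi * Complex.I : ℂ) ≠ 0 := Complex.two_pi_I_ne_zero
  have hpin : ‖(2 * Real.pi * Complex.I : ℂ)‖ = 2 * Real.pi := by
    simp [abs_of_pos Real.pi_pos]
  set c : ℂ := 2 * Real.pi * Complex.I with hc
  have hc1 : 1 ≤ ‖c‖ := by rw [hpin]; linarith [Real.pi_gt_three]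
  -- Integration by parts: the primitive `E / (c * ψ)` differs from the required one by an error
  -- coming from $\psi'=2t$. The factor $c=2\pi i$ only helps, as its norm exceeds 1.
  have hFd : ∀ s ∈ Set.Icc a b, HasDerivAt (fun s => E s / (c * ψ s))
      (E s - E s * (2 * t) / (c * ψ s ^ 2)) s := by
    intro s hs
    have := (hEd s).fun_div ((hψd s).const_mul c) (mul_ne_zero hpi (hψ0 s hs))
    convert! this using 1
    have := hψ0 s hs
    field_simp
  have hEc : Continuous E := continuous_iff_continuousAt.mpr fun s => (hEd s).continuousAt
  have hψc : Continuous ψ := continuous_iff_continuousAt.mpr fun s => (hψd s).continuousAt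
  have hgc : ContinuousOn (fun s => E s * (2 * t) / (c * ψ s ^ 2)) (Set.uIcc a b) := by
    rw [Set.uIcc_of_le hab]
    refine ContinuousOn.div (by fun_prop) (by fun_prop) fun s hs => ?_
    exact mul_ne_zero hpi (pow_ne_zero 2 (hψ0 s hs))
  have hint : IntervalIntegrable (fun s => E s * (2 * t) / (c * ψ s ^ 2)) volume a b :=
    hgc.intervalIntegrable
  have hEi : IntervalIntegrable E volume a b := hEc.intervalIntegrable _ _
  have ftc := intervalIntegral.integral_eq_sub_of_hasDerivAt
    (fun s hs => hFd s (by rwa [Set.uIcc_of_le hab] at hs)) (hEi.sub hint)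
  rw [intervalIntegral.integral_sub hEi hint] at ftc
  have heq : ∫ s in a..b, E s = E b / (c * ψ b) - E a / (c * ψ a) +
      ∫ s in a..b, E s * (2 * t) / (c * ψ s ^ 2) := by
    rw [← ftc]; ring
  have hbd : ∀ s ∈ Set.Icc a b, ‖E s / (c * ψ s)‖ ≤ 1 / l := by
    intro s hs
    rw [norm_div, norm_mul, hEn]
    have := hψn s hs
    apply one_div_le_one_div_of_le hl
    nlinarith
  have hin : ‖∫ s in a..b, E s * (2 * t) / (c * ψ s ^ 2)‖ ≤ 2 * |t| / l ^ 2 * |b - a| := by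
    refine intervalIntegral.norm_integral_le_of_norm_le_const fun s hs => ?_
    rw [Set.uIoc_of_le hab] at hs
    have := hψn s (Set.Ioc_subset_Icc_self hs)
    have h2 : l ^ 2 ≤ ‖ψ s‖ ^ 2 := by gcongr
    have : ‖(2 * t : ℂ)‖ = 2 * |t| := by simp
    rw [norm_div, norm_mul, this, hEn, norm_mul, norm_pow, one_mul]
    gcongr
    nlinarith [sq_nonneg l]
  rw [heq]
  refine (norm_add_le _ _).trans (add_le_add ((norm_sub_le _ _).trans ?_) (hin.trans_eq ?_))
  · refine (add_le_add (hbd b (Set.right_mem_Icc.mpr hab)) (hbd a (Set.left_mem_Icc.mpr hab))).trans_eq ?_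
    ring
  · rw [abs_of_nonneg (sub_nonneg.mpr hab)]; ring

/-- There is no stationary point in $[0,1]$: the term $2ts$ uses up at most half of $|u|$. -/
lemma norm_segExt_le_of_large {n j : ℕ} (hj : j < n) {u t : ℝ} (hu : 0 < |u|)
    (hut : 4 * |t| ≤ |u|) : ‖segExt n j u t‖ ≤ 6 / |u| := by
  have hn : (0 : ℝ) < n := by exact_mod_cast (Nat.zero_le j).trans_lt hj
  have hjn : (j : ℝ) + 1 ≤ n := by exact_mod_cast hj
  have hd : ((j : ℝ) + 1) / n - j / n = (n : ℝ)⁻¹ := by ring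
  have hn1 : (n : ℝ)⁻¹ ≤ 1 := inv_le_one_of_one_le₀ (by linarith [(Nat.cast_nonneg j : (0 : ℝ) ≤ j)])
  refine (norm_integral_exp_quadratic_le (l := |u| / 2) (by gcongr; linarith) (by positivity)
    fun s hs => ?_).trans ?_
  · have h0 : 0 ≤ s := (by positivity : (0 : ℝ) ≤ j / n).trans hs.1
    have h1 : s ≤ 1 := hs.2.trans ((div_le_one hn).mpr hjn)
    have h2 : |u| ≤ |u + 2 * t * s| + |2 * t * s| := by
      have := abs_sub (u + 2 * t * s) (2 * t * s)
      simpa using this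
    have h3 : |2 * t * s| ≤ 2 * |t| := by
      rw [abs_mul, abs_mul, abs_of_nonneg h0, abs_two]
      nlinarith [abs_nonneg t]
    linarith
  · rw [hd]
    have e : 6 / |u| = 2 / (|u| / 2) + 2 * (|u| / 4) * 1 / (|u| / 2) ^ 2 := by field_simp; norm_num
    rw [e]
    have : |t| ≤ |u| / 4 := by linarith
    gcongr

/-- Here $m$ is the distance from $j/n$ to the stationary point $-u/(2t)$ in units of $1/n$. On the
whole interval the distance is at least $m-1\ge m/2$ units, so the derivative of the phase is at
least $|t|m/n$. -/
lemma norm_segExt_le_of_far {n j : ℕ} (hj : j < n) {u t m : ℝ} (ht : t ≠ 0)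
    (hm : m = |j + n * u / (2 * t)|) (hm2 : 2 ≤ m) :
    ‖segExt n j u t‖ ≤ 3 * n / (|t| * m) := by
  have hn : (0 : ℝ) < n := by exact_mod_cast (Nat.zero_le j).trans_lt hj
  have ht' : 0 < |t| := abs_pos.mpr ht
  have hd : ((j : ℝ) + 1) / n - j / n = (n : ℝ)⁻¹ := by ring
  have hm0 : 0 < m := by linarith
  refine (norm_integral_exp_quadratic_le (l := |t| * m / n) (by gcongr; linarith) (by positivity)
    fun s hs => ?_).trans ?_
  · have h1 : |n * s - j| ≤ 1 := by
      have h1 := hs.1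
      have h2 := hs.2
      rw [div_le_iff₀ hn] at h1
      rw [le_div_iff₀ hn] at h2
      rw [abs_le]; constructor <;> nlinarith
    have h2 : m ≤ |n * s + n * u / (2 * t)| + |n * s - j| := by
      rw [hm]
      have := abs_sub (n * s + n * u / (2 * t)) (n * s - j)
      have e : n * s + n * u / (2 * t) - (n * s - j) = j + n * u / (2 * t) := by ring
      rwa [e] at this
    have h3 : m / 2 ≤ |n * s + n * u / (2 * t)| := by linarith
    have e : u + 2 * t * s = 2 * t / n * (n * s + n * u / (2 * t)) := by field_simp; ring
    rw [e, abs_mul, abs_div, abs_mul, abs_two, Nat.abs_cast]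
    calc |t| * m / n = 2 * |t| / n * (m / 2) := by ring
      _ ≤ _ := by gcongr
  · rw [hd]
    have e : 2 / (|t| * m / n) + 2 * |t| * (n : ℝ)⁻¹ / (|t| * m / n) ^ 2 =
        (2 * n * m + 2 * n) / (|t| * m ^ 2) := by field_simp
    have e2 : 3 * n / (|t| * m) = 3 * n * m / (|t| * m ^ 2) := by field_simp
    rw [e, e2]
    gcongr
    nlinarith

/-- A Lorentzian summed over unit steps. -/
lemma sum_inv_one_add_sq_le (n : ℕ) (y : ℝ) {D : ℝ} (hD : 1 ≤ D) :
    ∑ j : Fin n, (1 + ((j + y) / D) ^ 2)⁻¹ ≤ 10 * D := by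
  have hD0 : 0 < D := by linarith
  -- The sum is compared with increments of `arctan` and telescoped. Moving the point by at most 1
  -- costs a factor 3, and the total increment is at most $\pi$.
  have step : ∀ j : ℕ, (1 + ((j + y) / D) ^ 2)⁻¹ ≤
      3 * D * (Real.arctan (((j + 1 : ℕ) + y) / D) - Real.arctan ((j + y) / D)) := by
    intro j
    have hlt : ((j : ℝ) + y) / D < ((j + 1 : ℕ) + y) / D := by
      push_cast; gcongr; linarith
    obtain ⟨c, hc, hc'⟩ := exists_deriv_eq_slope Real.arctan hlt
      Real.continuous_arctan.continuousOn Real.differentiable_arctan.differentiableOn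
    have hdiff : ((j + 1 : ℕ) + y) / D - ((j : ℝ) + y) / D = D⁻¹ := by push_cast; ring
    simp only [hdiff, Real.deriv_arctan] at hc'
    have : Real.arctan (((j + 1 : ℕ) + y) / D) - Real.arctan ((j + y) / D) =
        (1 / (1 + c ^ 2)) * D⁻¹ := by
      rw [hc']; field_simp
    rw [this]
    have e : 3 * D * (1 / (1 + c ^ 2) * D⁻¹) = 3 / (1 + c ^ 2) := by field_simp
    rw [e, inv_eq_one_div, div_le_div_iff₀ (by positivity) (by positivity)]
    set w := ((j : ℝ) + y) / D
    have hD1 : D⁻¹ ≤ 1 := inv_le_one_of_one_le₀ hD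
    have h1 : 0 ≤ c - w := by linarith [hc.1]
    have h2 : c - w ≤ 1 := by linarith [hc.2]
    nlinarith [sq_nonneg (w - (c - w)), mul_nonneg h1 (sub_nonneg.mpr h2)]
  rw [Fin.sum_univ_eq_sum_range (fun j => (1 + ((j + y) / D) ^ 2)⁻¹)]
  refine (Finset.sum_le_sum fun j _ => step j).trans ?_
  rw [← Finset.mul_sum, Finset.sum_range_sub (fun j : ℕ => Real.arctan ((j + y) / D))]
  have h1 := Real.arctan_lt_pi_div_two ((n + y) / D)
  have h2 := Real.neg_pi_div_two_lt_arctan (((0 : ℕ) + y) / D)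
  have h3 := Real.pi_lt_d2
  nlinarith

/-- The square function of the parabola in the plane. -/
def segSq (n : ℕ) (u t : ℝ) : ℝ := ∑ j : Fin n, ‖segExt n j u t‖ ^ 2

lemma segSq_nonneg (n : ℕ) (u t : ℝ) : 0 ≤ segSq n u t := Finset.sum_nonneg fun _ _ => by positivity

lemma segSq_le_of_forall {n : ℕ} {u t B : ℝ} (h : ∀ j : Fin n, ‖segExt n j u t‖ ≤ B) :
    segSq n u t ≤ n * B ^ 2 := by
  refine (Finset.sum_le_sum fun j _ => pow_le_pow_left₀ (norm_nonneg _) (h j) 2).trans_eq ?_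
  simp

lemma segSq_le_inv {n : ℕ} (hn : 1 ≤ n) (u t : ℝ) : segSq n u t ≤ 1 / n := by
  have hn' : (0 : ℝ) < n := by exact_mod_cast hn
  refine (segSq_le_of_forall fun j => norm_segExt_le n j u t).trans_eq ?_
  field_simp

/-- About $D=n^2/T$ intervals around the stationary point contribute $n^{-2}$ each. Beyond them the
bound $9n^{-2}(D/m)^2$ takes over. A Lorentzian of width $D$ covers both regimes, and its sum is
$O(D)$. -/
lemma segSq_le_of_le_abs {n : ℕ} (hn : 1 ≤ n) {u t T : ℝ} (hT : n ≤ T) (hTt : T ≤ |t|)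
    (hTn : T ≤ (n : ℝ) ^ 2) : segSq n u t ≤ 100 / T := by
  have hn' : (0 : ℝ) < n := by exact_mod_cast hn
  have hT0 : 0 < T := hn'.trans_le hT
  have ht : t ≠ 0 := abs_pos.mp (hT0.trans_le hTt)
  set D := (n : ℝ) ^ 2 / T with hD
  have hD1 : 1 ≤ D := by rw [hD, one_le_div hT0]; exact hTn
  have hD0 : 0 < D := by linarith
  set y := n * u / (2 * t)
  have key : ∀ j : Fin n, ‖segExt n j u t‖ ^ 2 ≤
      10 * ((n : ℝ) ^ 2)⁻¹ * (1 + ((j + y) / D) ^ 2)⁻¹ := by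
    intro j
    rw [← div_eq_mul_inv, le_div_iff₀ (by positivity)]
    have h1 : ‖segExt n j u t‖ ^ 2 ≤ ((n : ℝ) ^ 2)⁻¹ := by
      rw [← inv_pow]
      exact pow_le_pow_left₀ (norm_nonneg _) (norm_segExt_le n j u t) 2
    have hsq : ((j + y) / D) ^ 2 = (|j + y| / D) ^ 2 := by
      rw [div_pow _ D, div_pow _ D, sq_abs]
    rw [hsq]
    rcases lt_or_ge |(j : ℝ) + y| 2 with hm | hm
    · have : (|j + y| / D) ^ 2 ≤ 2 ^ 2 := by
        gcongr
        exact (div_le_self (abs_nonneg _) hD1).trans hm.le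
      have hpos : (0 : ℝ) ≤ ((n : ℝ) ^ 2)⁻¹ := by positivity
      nlinarith [sq_nonneg ‖segExt n j u t‖]
    · have hm0 : 0 < |(j : ℝ) + y| := by linarith
      have h2 := norm_segExt_le_of_far j.2 ht rfl hm
      have h3 : ‖segExt n j u t‖ ≤ 3 * n / (T * |(j : ℝ) + y|) := h2.trans (by gcongr)
      have h4 := pow_le_pow_left₀ (norm_nonneg _) h3 2
      have h5 : ‖segExt n j u t‖ ^ 2 * (|j + y| / D) ^ 2 ≤ 9 * ((n : ℝ) ^ 2)⁻¹ := by
        refine (mul_le_mul_of_nonneg_right h4 (by positivity)).trans_eq ?_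
        rw [hD]; field_simp; norm_num
      linarith
  refine (Finset.sum_le_sum fun j _ => key j).trans ?_
  rw [← Finset.mul_sum]
  refine (mul_le_mul_of_nonneg_left (sum_inv_one_add_sq_le n y hD1) (by positivity)).trans_eq ?_
  rw [hD]; field_simp; norm_num

/-- Dispersion of packets that all start at the origin. If $|u|\ge4|t|$ the phase is non-stationary;
if $|u|$ and $|t|$ are $O(n)$ the trivial bound $1/n$ suffices; otherwise $|t|$ dominates and the
stationary-phase count applies. The truncation at $n^2$ reflects that at least one interval may
always contribute. -/
lemma segSq_le {n : ℕ} (hn : 1 ≤ n) (u t : ℝ) :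
    segSq n u t ≤ 400 / min (max (min (max (n : ℝ) |t|) ((n : ℝ) ^ 2)) |u|) ((n : ℝ) ^ 2) := by
  have hn1 : (1 : ℝ) ≤ n := by exact_mod_cast hn
  have hn' : (0 : ℝ) < n := by linarith
  have hnn : (n : ℝ) ≤ (n : ℝ) ^ 2 := by nlinarith
  set T := min (max (n : ℝ) |t|) ((n : ℝ) ^ 2) with hT
  have hTn : (n : ℝ) ≤ T := le_min (le_max_left _ _) hnn
  set ρ := min (max T |u|) ((n : ℝ) ^ 2) with hρ
  have hρn : (n : ℝ) ≤ ρ := le_min (hTn.trans (le_max_left _ _)) hnn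
  have hρ0 : 0 < ρ := by linarith
  have fin : ∀ {A x : ℝ}, 0 < x → 0 ≤ A → segSq n u t ≤ A / x → A * ρ ≤ 400 * x →
      segSq n u t ≤ 400 / ρ := by
    intro A x hx hA h1 h2
    refine h1.trans ?_
    rw [div_le_div_iff₀ hx hρ0]
    exact h2
  have htriv : ρ ≤ 4 * n → segSq n u t ≤ 400 / ρ := fun h =>
    fin hn' zero_le_one (segSq_le_inv hn u t) (by linarith)
  have hρm : ρ ≤ max T |u| := min_le_left _ _
  have hTm : T ≤ max (n : ℝ) |t| := min_le_left _ _
  rcases le_or_gt (4 * |t|) |u| with hut | hut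
  · rcases le_or_gt |u| n with hu | hu
    · apply htriv
      have : |t| ≤ n := by linarith [abs_nonneg t]
      have h2 : T ≤ n := hTm.trans (max_le le_rfl this)
      linarith [hρm.trans (max_le h2 hu)]
    · have hu0 : 0 < |u| := by linarith
      have h := segSq_le_of_forall (n := n) fun j => norm_segExt_le_of_large j.2 hu0 hut
      have hT2 : T ≤ |u| := hTm.trans (max_le hu.le (by linarith [abs_nonneg t]))
      have hρu : ρ ≤ |u| := hρm.trans (max_le hT2 le_rfl)
      refine fin hu0 (by norm_num : (0 : ℝ) ≤ 36) (h.trans ?_) (by linarith)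
      rw [le_div_iff₀ hu0]
      have : n * (6 / |u|) ^ 2 * |u| = 36 * (n / |u|) := by field_simp; norm_num
      rw [this]
      have : n / |u| ≤ 1 := (div_le_one hu0).mpr hu.le
      linarith
  · rcases le_or_gt |t| n with ht | ht
    · apply htriv
      have h2 : T ≤ n := hTm.trans (max_le le_rfl ht)
      exact hρm.trans (max_le (by linarith) (by linarith))
    · have hTe : T = min |t| ((n : ℝ) ^ 2) := by rw [hT, max_eq_right ht.le]
      have hT0 : 0 < T := by linarith
      refine fin hT0 (by norm_num : (0 : ℝ) ≤ 100)
        (segSq_le_of_le_abs hn hTn (hTe ▸ min_le_left _ _) (min_le_right _ _)) ?_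
      have : ρ ≤ 4 * T := by
        rcases le_total |t| ((n : ℝ) ^ 2) with h | h
        · rw [hTe, min_eq_left h]
          refine hρm.trans (max_le ?_ hut.le)
          rw [hTe, min_eq_left h]; linarith [abs_nonneg t]
        · rw [hTe, min_eq_right h]
          linarith [min_le_right (max T |u|) ((n : ℝ) ^ 2), sq_nonneg (n : ℝ)]
      linarith

/-! ### Integrating the square function -/

lemma lintegral_comp_div {T : ℝ} (hT : 0 < T) {f : ℝ → ℝ≥0∞} (hf : Measurable f) :
    ∫⁻ s, f (s / T) = ENNReal.ofReal T * ∫⁻ s, f s := by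
  have h2 := Real.map_volume_mul_right (a := T⁻¹) (inv_ne_zero hT.ne')
  have : ∫⁻ s, f (s / T) = ∫⁻ s, f s ∂(Measure.map (· * T⁻¹) volume) := by
    rw [lintegral_map hf (by fun_prop)]
    rfl
  rw [this, h2, lintegral_smul_measure, inv_inv, abs_of_pos hT, smul_eq_mul]

/-- The integral of `(1 + |s|) ^ (-r)`. -/
def bracketMass (r : ℝ) : ℝ≥0∞ := ∫⁻ s : ℝ, ENNReal.ofReal ((1 + |s|) ^ (-r))

lemma bracketMass_ne_top {r : ℝ} (hr : 1 < r) : bracketMass r ≠ ⊤ := by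
  have := finite_integral_one_add_norm (E := ℝ) (μ := volume) (r := r) (by simpa using hr)
  exact this.ne

lemma lintegral_bracket_div {r T : ℝ} (hT : 0 < T) :
    ∫⁻ s : ℝ, ENNReal.ofReal ((1 + |s| / T) ^ (-r)) = ENNReal.ofReal T * bracketMass r := by
  rw [bracketMass, ← lintegral_comp_div hT (by fun_prop)]
  congr 1
  ext s
  rw [abs_div, abs_of_pos hT]

lemma lintegral_bracket_div_sub {r T c : ℝ} (hT : 0 < T) :
    ∫⁻ s : ℝ, ENNReal.ofReal ((1 + |s - c| / T) ^ (-r)) = ENNReal.ofReal T * bracketMass r := by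
  rw [lintegral_sub_right_eq_self (fun s : ℝ => ENNReal.ofReal ((1 + |s| / T) ^ (-r))) c,
    lintegral_bracket_div hT]

/-- Fubini in `ℝ³`, with the last coordinate outermost. -/
lemma lintegral_euclidean_three {Φ : ℝ → ℝ → ℝ → ℝ≥0∞}
    (hΦ : Measurable fun p : ℝ × ℝ × ℝ => Φ p.1 p.2.1 p.2.2) :
    ∫⁻ x : EuclideanSpace ℝ (Fin 3), Φ (x 0) (x 1) (x 2) = ∫⁻ t, ∫⁻ u, ∫⁻ v, Φ u v t := by
  have h1 := (PiLp.volume_preserving_ofLp (Fin 3)).lintegral_comp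
    (f := fun y : Fin 3 → ℝ => Φ (y 0) (y 1) (y 2)) (by fun_prop)
  have h2 := (volume_preserving_piFinSuccAbove (fun _ : Fin 3 => ℝ) 2).lintegral_comp
    (f := fun y : ℝ × (Fin 2 → ℝ) => Φ (y.2 0) (y.2 1) y.1) (by fun_prop)
  rw [h1.trans (Eq.trans ?_ h2), Measure.volume_eq_prod, lintegral_prod _ (by fun_prop)]
  · refine lintegral_congr fun t => ?_
    have h3 := (volume_preserving_finTwoArrow ℝ).lintegral_comp
      (f := fun y : ℝ × ℝ => Φ y.1 y.2 t) (by fun_prop)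
    rw [Measure.volume_eq_prod, lintegral_prod _ (by fun_prop)] at h3
    exact h3
  · rfl

/-- A weight on the line at the scale `R`. -/
def lineWeight (R c s : ℝ) : ℝ := (1 + |s - c| / R) ^ (-2 : ℝ)

lemma lineWeight_nonneg {R : ℝ} (hR : 0 ≤ R) (c s : ℝ) : 0 ≤ lineWeight R c s := by
  unfold lineWeight; positivity

lemma measurable_lineWeight (R c : ℝ) : Measurable (lineWeight R c) := by
  unfold lineWeight; fun_prop

/-- Six of the hundred powers, two per coordinate, already give a product of integrable weights
suited to Fubini. -/
lemma ballWeight_le {R : ℝ} (hR : 0 < R) (c x : EuclideanSpace ℝ (Fin 3)) :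
    ballWeight c R x ≤ lineWeight R (c 0) (x 0) * lineWeight R (c 1) (x 1) *
      lineWeight R (c 2) (x 2) := by
  have h : ∀ i, |x i - c i| ≤ ‖x - c‖ := fun i => by
    simpa using PiLp.norm_apply_le (x - c) i
  have h2 : ∀ i, ((1 + ‖x - c‖ / R) ^ 2)⁻¹ ≤ lineWeight R (c i) (x i) := by
    intro i
    rw [lineWeight, Real.rpow_neg (by positivity), Real.rpow_two]
    gcongr
    exact h i
  have h0 : 0 ≤ ‖x - c‖ / R := by positivity
  have h1 : ballWeight c R x ≤ ((1 + ‖x - c‖ / R) ^ 2)⁻¹ * ((1 + ‖x - c‖ / R) ^ 2)⁻¹ *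
      ((1 + ‖x - c‖ / R) ^ 2)⁻¹ := by
    rw [ballWeight, ← mul_inv, ← mul_inv]
    gcongr
    rw [← pow_add, ← pow_add]
    exact pow_le_pow_right₀ (by linarith) (by norm_num)
  refine h1.trans ?_
  have l0 := lineWeight_nonneg hR.le (c 0) (x 0)
  have l1 := lineWeight_nonneg hR.le (c 1) (x 1)
  exact mul_le_mul (mul_le_mul (h2 0) (h2 1) (by positivity) l0) (h2 2) (by positivity)
    (mul_nonneg l0 l1)

lemma continuous_segSq (n : ℕ) : Continuous fun p : ℝ × ℝ => segSq n p.1 p.2 := by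
  unfold segSq
  exact continuous_finsetSum _ fun j _ => (continuous_segExt n j).norm.pow 2

lemma sum_norm_squareExt_sq {n : ℕ} (x : EuclideanSpace ℝ (Fin 3)) :
    ∑ q : Fin n × Fin n, ‖squareExt q x‖ ^ 2 = segSq n (x 0) (x 2) * segSq n (x 1) (x 2) := by
  rw [segSq, segSq, Finset.sum_mul_sum, ← Fintype.sum_prod_type']
  refine Finset.sum_congr rfl fun q _ => ?_
  rw [squareExt_eq_mul, norm_mul, mul_pow]

/-- The pointwise bound to the power $3/2$, with the maximum replaced by half the sum at the cost of
$2^{3/2}\le3$. The first term is integrable in $u$. The second, caused by the truncation at $n^2$,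
needs the weight. -/
lemma segSq_mul_sqrt_le {n : ℕ} (hn : 1 ≤ n) (u t : ℝ) {T : ℝ}
    (hT : T = min (max (n : ℝ) |t|) ((n : ℝ) ^ 2)) :
    segSq n u t * √(segSq n u t) ≤
      24000 * (T ^ (-(3 / 2) : ℝ) * (1 + |u| / T) ^ (-(3 / 2) : ℝ)) +
        8000 * ((n : ℝ) ^ 3)⁻¹ := by
  have hn1 : (1 : ℝ) ≤ n := by exact_mod_cast hn
  have hn' : (0 : ℝ) < n := by linarith
  have hnn : (n : ℝ) ≤ (n : ℝ) ^ 2 := by nlinarith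
  have h := segSq_le hn u t
  rw [← hT] at h
  have hTn : (n : ℝ) ≤ T := hT ▸ le_min (le_max_left _ _) hnn
  have hT0 : 0 < T := by linarith
  set ρ := min (max T |u|) ((n : ℝ) ^ 2) with hρ
  have hρ0 : 0 < ρ := lt_min (hT0.trans_le (le_max_left _ _)) (by positivity)
  have h1 : segSq n u t * √(segSq n u t) ≤ 400 / ρ * √(400 / ρ) := by gcongr
  have h2 : 400 / ρ * √(400 / ρ) = 8000 * ρ ^ (-(3 / 2) : ℝ) := by
    have e1 : ρ ^ (-(3 / 2) : ℝ) = ρ⁻¹ * √(ρ⁻¹) := by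
      rw [Real.sqrt_eq_rpow, ← Real.rpow_neg_one, ← Real.rpow_mul hρ0.le, ← Real.rpow_add hρ0]
      norm_num
    have e2 : √(400 / ρ) = 20 * √(ρ⁻¹) := by
      rw [div_eq_mul_inv, Real.sqrt_mul (by norm_num), show (400 : ℝ) = 20 ^ 2 by norm_num,
        Real.sqrt_sq (by norm_num)]
    rw [e1, e2]; ring
  have e3 : (T ^ (-(3 / 2) : ℝ) * (1 + |u| / T) ^ (-(3 / 2) : ℝ)) =
      (T + |u|) ^ (-(3 / 2) : ℝ) := by
    rw [← Real.mul_rpow (by positivity) (by positivity)]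
    congr 1; field_simp
  have hpos : 0 ≤ (T + |u|) ^ (-(3 / 2) : ℝ) := by positivity
  rw [e3]
  refine h1.trans (h2.trans_le ?_)
  rcases le_total (max T |u|) ((n : ℝ) ^ 2) with hc | hc
  · rw [hρ, min_eq_left hc]
    have h5 : (T + |u|) / 2 ≤ max T |u| := by
      linarith [le_max_left T |u|, le_max_right T |u|]
    have h6 : (max T |u|) ^ (-(3 / 2) : ℝ) ≤ ((T + |u|) / 2) ^ (-(3 / 2) : ℝ) :=
      Real.rpow_le_rpow_of_nonpos (by positivity) h5 (by norm_num)
    have h7 : ((T + |u|) / 2) ^ (-(3 / 2) : ℝ) ≤ 3 * (T + |u|) ^ (-(3 / 2) : ℝ) := by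
      rw [div_eq_mul_inv, Real.mul_rpow (by positivity) (by positivity), mul_comm]
      gcongr
      rw [Real.inv_rpow (by norm_num), Real.rpow_neg (by norm_num), inv_inv,
        show (3 / 2 : ℝ) = 1 + 1 / 2 by norm_num, Real.rpow_add (by norm_num), Real.rpow_one,
        ← Real.sqrt_eq_rpow]
      have : √2 ≤ 3 / 2 := by rw [Real.sqrt_le_left (by norm_num)]; norm_num
      linarith
    have : 0 ≤ ((n : ℝ) ^ 3)⁻¹ := by positivity
    linarith
  · rw [hρ, min_eq_right hc]
    have : ((n : ℝ) ^ 2) ^ (-(3 / 2) : ℝ) = ((n : ℝ) ^ 3)⁻¹ := by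
      rw [← Real.rpow_natCast, ← Real.rpow_mul hn'.le, ← Real.rpow_natCast, ← Real.rpow_neg hn'.le]
      norm_num
    rw [this]
    linarith

/-- The main term gives $T^{-3/2}\cdot T$. The truncated one gives $n^{-3}\cdot n^2=n^{-1}\le
T^{-1/2}$, because $T\le n^2$. -/
lemma lintegral_segSq_le {n : ℕ} (hn : 1 ≤ n) (t c : ℝ) {T : ℝ}
    (hT : T = min (max (n : ℝ) |t|) ((n : ℝ) ^ 2)) :
    ∫⁻ u, ENNReal.ofReal (segSq n u t * √(segSq n u t) * lineWeight ((n : ℝ) ^ 2) c u) ≤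
      (24000 * bracketMass (3 / 2) + 8000 * bracketMass 2) * ENNReal.ofReal (T ^ (-(1 / 2) : ℝ)) := by
  have hn1 : (1 : ℝ) ≤ n := by exact_mod_cast hn
  have hn' : (0 : ℝ) < n := by linarith
  have hnn : (n : ℝ) ≤ (n : ℝ) ^ 2 := by nlinarith
  have hTn : (n : ℝ) ≤ T := hT ▸ le_min (le_max_left _ _) hnn
  have hTn2 : T ≤ (n : ℝ) ^ 2 := hT ▸ min_le_right _ _
  have hT0 : 0 < T := by linarith
  have hpt : ∀ u, ENNReal.ofReal (segSq n u t * √(segSq n u t) * lineWeight ((n : ℝ) ^ 2) c u) ≤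
      ENNReal.ofReal (24000 * T ^ (-(3 / 2) : ℝ)) * ENNReal.ofReal ((1 + |u| / T) ^ (-(3 / 2) : ℝ)) +
      ENNReal.ofReal (8000 * ((n : ℝ) ^ 3)⁻¹) *
        ENNReal.ofReal ((1 + |u - c| / (n : ℝ) ^ 2) ^ (-2 : ℝ)) := by
    intro u
    rw [← ENNReal.ofReal_mul (by positivity), ← ENNReal.ofReal_mul (by positivity),
      ← ENNReal.ofReal_add (by positivity) (by positivity)]
    apply ENNReal.ofReal_le_ofReal
    have hw0 : 0 ≤ lineWeight ((n : ℝ) ^ 2) c u := by unfold lineWeight; positivity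
    have hw1 : lineWeight ((n : ℝ) ^ 2) c u ≤ 1 := by
      apply Real.rpow_le_one_of_one_le_of_nonpos _ (by norm_num)
      have : 0 ≤ |u - c| / (n : ℝ) ^ 2 := by positivity
      linarith
    refine (mul_le_mul_of_nonneg_right (segSq_mul_sqrt_le hn u t hT) hw0).trans ?_
    rw [add_mul]
    apply add_le_add
    · exact (mul_le_of_le_one_right (by positivity) hw1).trans_eq (by ring)
    · rfl
  refine (lintegral_mono hpt).trans ?_
  rw [lintegral_add_left (by fun_prop), lintegral_const_mul _ (by fun_prop),
    lintegral_const_mul _ (by fun_prop), lintegral_bracket_div hT0,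
    lintegral_bracket_div_sub (by positivity), add_mul]
  apply add_le_add
  · rw [← mul_assoc, ← ENNReal.ofReal_mul (by positivity)]
    have : 24000 * T ^ (-(3 / 2) : ℝ) * T = 24000 * T ^ (-(1 / 2) : ℝ) := by
      rw [mul_assoc, ← Real.rpow_add_one hT0.ne']; norm_num
    rw [this, ENNReal.ofReal_mul (by norm_num)]
    apply le_of_eq
    simp only [ENNReal.ofReal_ofNat]
    ring
  · rw [← mul_assoc, ← ENNReal.ofReal_mul (by positivity)]
    have : 8000 * ((n : ℝ) ^ 3)⁻¹ * (n : ℝ) ^ 2 ≤ 8000 * T ^ (-(1 / 2) : ℝ) := by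
      have e : 8000 * ((n : ℝ) ^ 3)⁻¹ * (n : ℝ) ^ 2 = 8000 * (n : ℝ)⁻¹ := by field_simp
      rw [e]
      have : ((n : ℝ) ^ 2) ^ (-(1 / 2) : ℝ) ≤ T ^ (-(1 / 2) : ℝ) :=
        Real.rpow_le_rpow_of_nonpos hT0 hTn2 (by norm_num)
      have e2 : ((n : ℝ) ^ 2) ^ (-(1 / 2) : ℝ) = (n : ℝ)⁻¹ := by
        rw [Real.rpow_neg (by positivity), ← Real.sqrt_eq_rpow, Real.sqrt_sq hn'.le]
      linarith
    refine (mul_le_mul_left (ENNReal.ofReal_le_ofReal this) _).trans_eq ?_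
    rw [ENNReal.ofReal_mul (by norm_num)]
    simp only [ENNReal.ofReal_ofNat]
    ring

/-- The integral of $1/|t|$ up to $n^2$ is logarithmic. It is made convergent by inserting
$(1+|t|)^{-\varepsilon}$, paid for by $R^\varepsilon$. For $|t|\ge n^2$ the weight of scale $n^2$
compensates the constant $n^{-2}$. -/
lemma lintegral_inv_truncation_le {ε : ℝ} (hε : 0 < ε) {n : ℕ} (hn : 1 ≤ n) (c : ℝ) :
    ∫⁻ t, ENNReal.ofReal ((min (max (n : ℝ) |t|) ((n : ℝ) ^ 2))⁻¹ * lineWeight ((n : ℝ) ^ 2) c t) ≤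
      (ENNReal.ofReal (2 * 2 ^ ε) * bracketMass (1 + ε) + bracketMass 2) *
        ENNReal.ofReal (((n : ℝ) ^ 2) ^ ε) := by
  have hn1 : (1 : ℝ) ≤ n := by exact_mod_cast hn
  have hn' : (0 : ℝ) < n := by linarith
  have hnn : (n : ℝ) ≤ (n : ℝ) ^ 2 := by nlinarith
  have hpt : ∀ t, ENNReal.ofReal ((min (max (n : ℝ) |t|) ((n : ℝ) ^ 2))⁻¹ *
      lineWeight ((n : ℝ) ^ 2) c t) ≤
      ENNReal.ofReal (2 * (2 * (n : ℝ) ^ 2) ^ ε) * ENNReal.ofReal ((1 + |t|) ^ (-(1 + ε))) +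
      ENNReal.ofReal (((n : ℝ) ^ 2)⁻¹) *
        ENNReal.ofReal ((1 + |t - c| / (n : ℝ) ^ 2) ^ (-2 : ℝ)) := by
    intro t
    rw [← ENNReal.ofReal_mul (by positivity), ← ENNReal.ofReal_mul (by positivity),
      ← ENNReal.ofReal_add (by positivity) (by positivity)]
    apply ENNReal.ofReal_le_ofReal
    have hw0 : 0 ≤ lineWeight ((n : ℝ) ^ 2) c t := by unfold lineWeight; positivity
    have hw1 : lineWeight ((n : ℝ) ^ 2) c t ≤ 1 := by
      apply Real.rpow_le_one_of_one_le_of_nonpos _ (by norm_num)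
      have : 0 ≤ |t - c| / (n : ℝ) ^ 2 := by positivity
      linarith
    rcases le_total (max (n : ℝ) |t|) ((n : ℝ) ^ 2) with h | h
    · rw [min_eq_left h]
      have h1 : (1 + |t|) / 2 ≤ max (n : ℝ) |t| := by
        linarith [le_max_left (n : ℝ) |t|, le_max_right (n : ℝ) |t|]
      have h2 : 1 + |t| ≤ 2 * (n : ℝ) ^ 2 := by linarith
      have h3 : (max (n : ℝ) |t|)⁻¹ ≤ 2 * (1 + |t|)⁻¹ := by
        refine (inv_anti₀ (by positivity) h1).trans_eq ?_
        field_simp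
      have h4 : (1 + |t|)⁻¹ ≤ (2 * (n : ℝ) ^ 2) ^ ε * (1 + |t|) ^ (-(1 + ε)) := by
        have e : (1 + |t|)⁻¹ = (1 + |t|) ^ ε * (1 + |t|) ^ (-(1 + ε)) := by
          rw [← Real.rpow_add (by positivity), ← Real.rpow_neg_one]
          congr 1; ring
        rw [e]
        gcongr
      have h5 : (max (n : ℝ) |t|)⁻¹ * lineWeight ((n : ℝ) ^ 2) c t ≤ (max (n : ℝ) |t|)⁻¹ :=
        mul_le_of_le_one_right (by positivity) hw1
      have h6 : 0 ≤ ((n : ℝ) ^ 2)⁻¹ * (1 + |t - c| / (n : ℝ) ^ 2) ^ (-2 : ℝ) := by positivity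
      linarith
    · rw [min_eq_right h]
      have : 0 ≤ 2 * (2 * (n : ℝ) ^ 2) ^ ε * (1 + |t|) ^ (-(1 + ε)) := by positivity
      unfold lineWeight
      linarith
  refine (lintegral_mono hpt).trans ?_
  rw [lintegral_add_left (by fun_prop), lintegral_const_mul _ (by fun_prop),
    lintegral_const_mul _ (by fun_prop), lintegral_bracket_div_sub (by positivity), add_mul]
  apply add_le_add
  · rw [← bracketMass, Real.mul_rpow (by norm_num) (by positivity), ← mul_assoc,
      ENNReal.ofReal_mul (by positivity)]
    apply le_of_eq; ring
  · rw [← mul_assoc, ← ENNReal.ofReal_mul (by positivity), inv_mul_cancel₀ (by positivity),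
      ENNReal.ofReal_one, one_mul]
    refine le_mul_of_one_le_right zero_le ?_
    rw [ENNReal.one_le_ofReal]
    exact Real.one_le_rpow (by linarith) hε.le

/-- The constant in the Kakeya-type estimate for the square function. -/
def squareFunctionConst (ε : ℝ) : ℝ≥0∞ :=
  (24000 * bracketMass (3 / 2) + 8000 * bracketMass 2) ^ 2 *
    (ENNReal.ofReal (2 * 2 ^ ε) * bracketMass (1 + ε) + bracketMass 2)

lemma squareFunctionConst_ne_top {ε : ℝ} (hε : 0 < ε) : squareFunctionConst ε ≠ ⊤ := by
  have h1 := bracketMass_ne_top (r := 3 / 2) (by norm_num)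
  have h2 := bracketMass_ne_top (r := 2) (by norm_num)
  have h3 := bracketMass_ne_top (r := 1 + ε) (by linarith)
  unfold squareFunctionConst
  finiteness

lemma lintegral_euclidean_three_mul {G H : ℝ → ℝ → ℝ≥0∞} {W : ℝ → ℝ≥0∞}
    (hG : Measurable fun p : ℝ × ℝ => G p.1 p.2) (hH : Measurable fun p : ℝ × ℝ => H p.1 p.2)
    (hW : Measurable W) :
    ∫⁻ x : EuclideanSpace ℝ (Fin 3), G (x 2) (x 0) * H (x 2) (x 1) * W (x 2) =
      ∫⁻ t, (∫⁻ u, G t u) * (∫⁻ v, H t v) * W t := by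
  have m1 : Measurable fun p : ℝ × ℝ × ℝ => G p.2.2 p.1 :=
    hG.comp (by fun_prop : Measurable fun p : ℝ × ℝ × ℝ => (p.2.2, p.1))
  have m2 : Measurable fun p : ℝ × ℝ × ℝ => H p.2.2 p.2.1 :=
    hH.comp (by fun_prop : Measurable fun p : ℝ × ℝ × ℝ => (p.2.2, p.2.1))
  have m3 : Measurable fun p : ℝ × ℝ × ℝ => W p.2.2 := hW.comp (by fun_prop)
  rw [lintegral_euclidean_three (Φ := fun u v t => G t u * H t v * W t) ((m1.mul m2).mul m3)]
  refine lintegral_congr fun t => ?_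
  have n1 : Measurable (G t) := hG.comp measurable_prodMk_left
  have n2 : Measurable (H t) := hH.comp measurable_prodMk_left
  have : ∀ u, ∫⁻ v, G t u * H t v * W t = G t u * ((∫⁻ v, H t v) * W t) := by
    intro u
    rw [lintegral_mul_const _ (n2.const_mul _), lintegral_const_mul _ n2, mul_assoc]
  simp only [this]
  rw [lintegral_mul_const _ n1, mul_assoc]

/-- The density of the square function in one of the horizontal directions. -/
def segDensity (n : ℕ) (c t u : ℝ) : ℝ≥0∞ :=
  ENNReal.ofReal (segSq n u t * √(segSq n u t) * lineWeight ((n : ℝ) ^ 2) c u)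

lemma measurable_segDensity (n : ℕ) (c : ℝ) :
    Measurable fun p : ℝ × ℝ => segDensity n c p.1 p.2 := by
  have h0 := ((continuous_segSq n).comp (continuous_snd.prodMk continuous_fst)).measurable
  have h1 : Measurable fun p : ℝ × ℝ => segSq n p.2 p.1 := h0
  have h2 : Measurable fun p : ℝ × ℝ => lineWeight ((n : ℝ) ^ 2) c p.2 :=
    (measurable_lineWeight _ c).comp measurable_snd
  exact ((h1.mul h1.sqrt).mul h2).ennreal_ofReal

lemma squareFunction_le_segDensity {n : ℕ} (hn : 1 ≤ n)
    {a : Fin n × Fin n → ℂ} (ha : ∀ q, ‖a q‖ ≤ 1) (c x : EuclideanSpace ℝ (Fin 3)) :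
    ENNReal.ofReal ((∑ q, ‖a q * squareExt q x‖ ^ 2) * √(∑ q, ‖a q * squareExt q x‖ ^ 2) *
      ballWeight c ((n : ℝ) ^ 2) x) ≤
    segDensity n (c 0) (x 2) (x 0) * segDensity n (c 1) (x 2) (x 1) *
      ENNReal.ofReal (lineWeight ((n : ℝ) ^ 2) (c 2) (x 2)) := by
  have hn' : (0 : ℝ) < n := by exact_mod_cast hn
  have h1 : ∑ q, ‖a q * squareExt q x‖ ^ 2 ≤ segSq n (x 0) (x 2) * segSq n (x 1) (x 2) := by
    rw [← sum_norm_squareExt_sq]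
    refine Finset.sum_le_sum fun q _ => pow_le_pow_left₀ (norm_nonneg _) ?_ 2
    rw [norm_mul]
    exact mul_le_of_le_one_left (norm_nonneg _) (ha q)
  have g0 := segSq_nonneg n (x 0) (x 2)
  have g1 := segSq_nonneg n (x 1) (x 2)
  have h0 : 0 ≤ ∑ q, ‖a q * squareExt q x‖ ^ 2 := Finset.sum_nonneg fun _ _ => by positivity
  have hb0 : 0 ≤ ballWeight c ((n : ℝ) ^ 2) x := by unfold ballWeight; positivity
  have l0 := lineWeight_nonneg (R := (n : ℝ) ^ 2) (by positivity) (c 0) (x 0)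
  have l1 := lineWeight_nonneg (R := (n : ℝ) ^ 2) (by positivity) (c 1) (x 1)
  have hb := ballWeight_le (R := (n : ℝ) ^ 2) (by positivity) c x
  unfold segDensity
  rw [← ENNReal.ofReal_mul (by positivity), ← ENNReal.ofReal_mul (by positivity)]
  apply ENNReal.ofReal_le_ofReal
  have h2 := mul_le_mul h1 (Real.sqrt_le_sqrt h1) (Real.sqrt_nonneg _) (mul_nonneg g0 g1)
  refine (mul_le_mul h2 hb hb0 (by positivity)).trans_eq ?_
  rw [Real.sqrt_mul g0]; ring

/-- At fixed $t$ each horizontal integral is $O(T^{-1/2})$, so the two together give $1/T$. -/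
lemma lintegral_squareFunction_le {ε : ℝ} (hε : 0 < ε) {n : ℕ} (hn : 1 ≤ n)
    {a : Fin n × Fin n → ℂ} (ha : ∀ q, ‖a q‖ ≤ 1) (c : EuclideanSpace ℝ (Fin 3)) :
    ∫⁻ x, ENNReal.ofReal ((∑ q, ‖a q * squareExt q x‖ ^ 2) * √(∑ q, ‖a q * squareExt q x‖ ^ 2) *
      ballWeight c ((n : ℝ) ^ 2) x) ≤
    squareFunctionConst ε * ENNReal.ofReal (((n : ℝ) ^ 2) ^ ε) := by
  have hn' : (0 : ℝ) < n := by exact_mod_cast hn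
  refine (lintegral_mono fun x => squareFunction_le_segDensity hn ha c x).trans ?_
  have hW : Measurable fun t => ENNReal.ofReal (lineWeight ((n : ℝ) ^ 2) (c 2) t) :=
    (measurable_lineWeight _ _).ennreal_ofReal
  rw [lintegral_euclidean_three_mul (measurable_segDensity n _) (measurable_segDensity n _) hW]
  have hpt : ∀ t, (∫⁻ u, segDensity n (c 0) t u) * (∫⁻ v, segDensity n (c 1) t v) *
      ENNReal.ofReal (lineWeight ((n : ℝ) ^ 2) (c 2) t) ≤
      (24000 * bracketMass (3 / 2) + 8000 * bracketMass 2) ^ 2 *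
        ENNReal.ofReal ((min (max (n : ℝ) |t|) ((n : ℝ) ^ 2))⁻¹ *
          lineWeight ((n : ℝ) ^ 2) (c 2) t) := by
    intro t
    have hT0 : 0 < min (max (n : ℝ) |t|) ((n : ℝ) ^ 2) :=
      lt_min (hn'.trans_le (le_max_left _ _)) (by positivity)
    have h0 : ∫⁻ u, segDensity n (c 0) t u ≤ _ := lintegral_segSq_le hn t (c 0) rfl
    have h1 : ∫⁻ u, segDensity n (c 1) t u ≤ _ := lintegral_segSq_le hn t (c 1) rfl
    generalize min (max (n : ℝ) |t|) ((n : ℝ) ^ 2) = T at *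
    generalize 24000 * bracketMass (3 / 2) + 8000 * bracketMass 2 = K at *
    have : T⁻¹ = T ^ (-(1 / 2) : ℝ) * T ^ (-(1 / 2) : ℝ) := by
      rw [← Real.rpow_add hT0, ← Real.rpow_neg_one]; norm_num
    rw [this, ENNReal.ofReal_mul (by positivity), ENNReal.ofReal_mul (by positivity)]
    calc _ ≤ (K * ENNReal.ofReal (T ^ (-(1 / 2) : ℝ))) * (K * ENNReal.ofReal (T ^ (-(1 / 2) : ℝ))) *
          ENNReal.ofReal (lineWeight ((n : ℝ) ^ 2) (c 2) t) := by gcongr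
      _ = _ := by ring
  refine (lintegral_mono hpt).trans ?_
  rw [lintegral_const_mul _ (by have := measurable_lineWeight ((n : ℝ) ^ 2) (c 2); fun_prop),
    squareFunctionConst, mul_assoc]
  gcongr
  exact lintegral_inv_truncation_le hε hn (c 2)

/-! ### Weighted integrals and integrals over balls -/

lemma ballWeight_nonneg {R : ℝ} (hR : 0 < R) (c x : EuclideanSpace ℝ (Fin 3)) :
    0 ≤ ballWeight c R x := by
  unfold ballWeight; positivity

lemma continuous_ballWeight {R : ℝ} (hR : 0 < R) (c : EuclideanSpace ℝ (Fin 3)) :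
    Continuous (ballWeight c R) := by
  unfold ballWeight
  refine Continuous.inv₀ (by fun_prop) fun x => ?_
  positivity

lemma ballWeight_eq {R : ℝ} (hR : 0 < R) (c x : EuclideanSpace ℝ (Fin 3)) :
    ballWeight c R x = (1 + ‖R⁻¹ • (x - c)‖) ^ (-100 : ℝ) := by
  rw [ballWeight, norm_smul, Real.norm_of_nonneg (by positivity), Real.rpow_neg (by positivity),
    inv_mul_eq_div, ← Real.rpow_natCast]
  norm_num

lemma integrable_ballWeight {R : ℝ} (hR : 0 < R) (c : EuclideanSpace ℝ (Fin 3)) :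
    Integrable (ballWeight c R) := by
  have h := integrable_one_add_norm (E := EuclideanSpace ℝ (Fin 3)) (μ := volume) (r := 100)
    (by rw [finrank_euclideanSpace_fin]; norm_num)
  have h2 := (h.comp_smul (inv_ne_zero hR.ne')).comp_sub_right c
  exact h2.congr (Filter.Eventually.of_forall fun x => (ballWeight_eq hR c x).symm)

/-- The total mass of the weight of the unit ball. -/
def weightMass : ℝ≥0∞ :=
  ∫⁻ x : EuclideanSpace ℝ (Fin 3), ENNReal.ofReal ((1 + ‖x‖) ^ (-100 : ℝ))

lemma weightMass_ne_top : weightMass ≠ ⊤ :=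
  (finite_integral_one_add_norm (E := EuclideanSpace ℝ (Fin 3)) (μ := volume) (r := 100)
    (by rw [finrank_euclideanSpace_fin]; norm_num)).ne

lemma lintegral_ballWeight {R : ℝ} (hR : 0 < R) (c : EuclideanSpace ℝ (Fin 3)) :
    ∫⁻ x, ENNReal.ofReal (ballWeight c R x) = ENNReal.ofReal (R ^ 3) * weightMass := by
  simp only [ballWeight_eq hR]
  rw [lintegral_sub_right_eq_self
    (fun x : EuclideanSpace ℝ (Fin 3) => ENNReal.ofReal ((1 + ‖R⁻¹ • x‖) ^ (-100 : ℝ))) c]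
  have hm : Measurable fun x : EuclideanSpace ℝ (Fin 3) =>
      ENNReal.ofReal ((1 + ‖x‖) ^ (-100 : ℝ)) := by fun_prop
  rw [← lintegral_map (g := fun x => R⁻¹ • x) hm (by fun_prop),
    Measure.map_addHaar_smul _ (inv_ne_zero hR.ne'), lintegral_smul_measure, smul_eq_mul,
    weightMass]
  congr 2
  rw [finrank_euclideanSpace_fin, inv_pow, inv_inv, abs_of_pos (by positivity)]

lemma ballWeight_le_mul {R : ℝ} (hR : 0 < R) {c x y : EuclideanSpace ℝ (Fin 3)}
    (hxy : ‖y - x‖ ≤ R) : ballWeight c R x ≤ 2 ^ 100 * ballWeight c R y := by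
  have h1 : 1 + ‖y - c‖ / R ≤ 2 * (1 + ‖x - c‖ / R) := by
    have h2 : ‖y - c‖ ≤ ‖y - x‖ + ‖x - c‖ := by
      simpa using norm_add_le (y - x) (x - c)
    have h3 : ‖y - c‖ / R ≤ (R + ‖x - c‖) / R := by gcongr; linarith
    rw [add_div, div_self hR.ne'] at h3
    have : 0 ≤ ‖x - c‖ / R := by positivity
    linarith
  have h4 : (1 + ‖y - c‖ / R) ^ 100 ≤ 2 ^ 100 * (1 + ‖x - c‖ / R) ^ 100 := by
    rw [← mul_pow]; gcongr
  unfold ballWeight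
  rw [← div_eq_mul_inv, le_div_iff₀ (by positivity), inv_mul_le_iff₀ (by positivity)]
  linarith

/-- The constant in the comparison of weighted integrals with integrals over balls. -/
def weightConst : ℝ≥0∞ :=
  2 ^ 100 * weightMass / volume (Metric.ball (0 : EuclideanSpace ℝ (Fin 3)) 1)

lemma weightConst_ne_top : weightConst ≠ ⊤ := by
  have h1 := weightMass_ne_top
  have h2 : volume (Metric.ball (0 : EuclideanSpace ℝ (Fin 3)) 1) ≠ 0 :=
    (Metric.measure_ball_pos _ _ one_pos).ne'
  exact ENNReal.div_ne_top (by finiteness) h2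

/-- The weight is nearly constant at scale $R$, so $w(x)$ is dominated by its mean over $B(x,R)$.
Exchanging integrals turns the left side into an average of ball integrals of `f`; the mass of $w$
and the volume of the ball are both multiples of $R^3$. -/
lemma lintegral_mul_ballWeight_le {f : EuclideanSpace ℝ (Fin 3) → ℝ≥0∞} (hf : Measurable f)
    {R : ℝ} (hR : 0 < R) {A : ℝ≥0∞} (hA : ∀ y, ∫⁻ x in Metric.ball y R, f x ≤ A)
    (c : EuclideanSpace ℝ (Fin 3)) :
    ∫⁻ x, f x * ENNReal.ofReal (ballWeight c R x) ≤ weightConst * A := by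
  set w : EuclideanSpace ℝ (Fin 3) → ℝ≥0∞ := fun x => ENNReal.ofReal (ballWeight c R x) with hw
  have hwm : Measurable w := (continuous_ballWeight hR c).measurable.ennreal_ofReal
  set v := volume (Metric.ball (0 : EuclideanSpace ℝ (Fin 3)) 1) with hv
  have hv0 : v ≠ 0 := (Metric.measure_ball_pos _ _ one_pos).ne'
  have hvt : v ≠ ⊤ := measure_ball_lt_top.ne
  have hR3 : ENNReal.ofReal (R ^ 3) ≠ 0 := by
    rw [Ne, ENNReal.ofReal_eq_zero, not_le]; positivity
  have hvol : ∀ x : EuclideanSpace ℝ (Fin 3), volume (Metric.ball x R) = ENNReal.ofReal (R ^ 3) * v := by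
    intro x
    rw [Measure.addHaar_ball_of_pos _ _ hR, finrank_euclideanSpace_fin]
  have hpt : ∀ x, w x * (ENNReal.ofReal (R ^ 3) * v) ≤
      ∫⁻ y, (Metric.ball x R).indicator (fun y => 2 ^ 100 * w y) y := by
    intro x
    rw [lintegral_indicator Metric.isOpen_ball.measurableSet, ← hvol x,
      ← setLIntegral_const (Metric.ball x R) (w x)]
    refine setLIntegral_mono' Metric.isOpen_ball.measurableSet fun y hy => ?_
    rw [mem_ball_iff_norm] at hy
    have := ENNReal.ofReal_le_ofReal (ballWeight_le_mul (c := c) hR hy.le)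
    rwa [ENNReal.ofReal_mul (by norm_num), ENNReal.ofReal_pow (by norm_num),
      ENNReal.ofReal_ofNat] at this
  have hind : ∀ x y, f x * (Metric.ball x R).indicator (fun y => 2 ^ 100 * w y) y =
      2 ^ 100 * w y * (Metric.ball y R).indicator f x := by
    intro x y
    by_cases h : y ∈ Metric.ball x R
    · rw [Set.indicator_of_mem h, Set.indicator_of_mem (Metric.mem_ball_comm.mp h), mul_comm]
    · rw [Set.indicator_of_notMem h, Set.indicator_of_notMem (fun h' => h (Metric.mem_ball_comm.mp h')),
        mul_zero, mul_zero]
  have hmeas : Measurable fun p : EuclideanSpace ℝ (Fin 3) × EuclideanSpace ℝ (Fin 3) =>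
      2 ^ 100 * w p.2 * (Metric.ball p.2 R).indicator f p.1 := by
    have : (fun p : EuclideanSpace ℝ (Fin 3) × EuclideanSpace ℝ (Fin 3) =>
        (Metric.ball p.2 R).indicator f p.1) =
        {p : EuclideanSpace ℝ (Fin 3) × EuclideanSpace ℝ (Fin 3) | dist p.1 p.2 < R}.indicator
          fun p => f p.1 := by
      ext p
      simp [Set.indicator, Metric.mem_ball]
    refine ((hwm.comp measurable_snd).const_mul _).mul ?_
    rw [this]
    exact (hf.comp measurable_fst).indicator (isOpen_lt (by fun_prop) (by fun_prop)).measurableSet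
  have key : (∫⁻ x, f x * w x) * (ENNReal.ofReal (R ^ 3) * v) ≤
      2 ^ 100 * (ENNReal.ofReal (R ^ 3) * weightMass) * A := by
    calc (∫⁻ x, f x * w x) * (ENNReal.ofReal (R ^ 3) * v)
        = ∫⁻ x, f x * (w x * (ENNReal.ofReal (R ^ 3) * v)) := by
          rw [← lintegral_mul_const (f := fun x => f x * w x) _ (hf.mul hwm)]
          simp only [mul_assoc]
      _ ≤ ∫⁻ x, f x * ∫⁻ y, (Metric.ball x R).indicator (fun y => 2 ^ 100 * w y) y :=
          lintegral_mono fun x => mul_le_mul_right (hpt x) _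
      _ = ∫⁻ x, ∫⁻ y, 2 ^ 100 * w y * (Metric.ball y R).indicator f x := by
          refine lintegral_congr fun x => ?_
          rw [← lintegral_const_mul _ ((hwm.const_mul _).indicator Metric.isOpen_ball.measurableSet)]
          simp only [hind]
      _ = ∫⁻ y, ∫⁻ x, 2 ^ 100 * w y * (Metric.ball y R).indicator f x :=
          lintegral_lintegral_swap hmeas.aemeasurable
      _ ≤ ∫⁻ y, 2 ^ 100 * w y * A := by
          refine lintegral_mono fun y => ?_
          dsimp only
          rw [lintegral_const_mul _ (hf.indicator Metric.isOpen_ball.measurableSet),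
            lintegral_indicator Metric.isOpen_ball.measurableSet]
          exact mul_le_mul_right (hA y) _
      _ = _ := by
          rw [lintegral_mul_const _ (hwm.const_mul _), lintegral_const_mul _ hwm,
            lintegral_ballWeight hR]
  have hRv0 : ENNReal.ofReal (R ^ 3) * v ≠ 0 := mul_ne_zero hR3 hv0
  have hRvt : ENNReal.ofReal (R ^ 3) * v ≠ ⊤ := ENNReal.mul_ne_top ENNReal.ofReal_ne_top hvt
  rw [← ENNReal.mul_le_mul_iff_left hRv0 hRvt]
  refine key.trans_eq ?_
  rw [weightConst, ← hv, ENNReal.div_eq_inv_mul]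
  calc _ = (v⁻¹ * v) * (2 ^ 100 * (ENNReal.ofReal (R ^ 3) * weightMass) * A) := by
        rw [ENNReal.inv_mul_cancel hv0 hvt, one_mul]
    _ = _ := by ring

/-! ### Self-improvement to a reverse square function estimate -/

/-- A linear combination of the functions `squareExt q`. -/
def squareSum {n : ℕ} (a : Fin n × Fin n → ℂ) (x : EuclideanSpace ℝ (Fin 3)) : ℂ :=
  ∑ q, a q * squareExt q x

/-- The square function of a linear combination of the functions `squareExt q`, cubed. -/
def squareFunction {n : ℕ} (a : Fin n × Fin n → ℂ) (x : EuclideanSpace ℝ (Fin 3)) : ℝ :=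
  (∑ q, ‖a q * squareExt q x‖ ^ 2) * √(∑ q, ‖a q * squareExt q x‖ ^ 2)

lemma squareFunction_nonneg {n : ℕ} (a : Fin n × Fin n → ℂ) (x : EuclideanSpace ℝ (Fin 3)) :
    0 ≤ squareFunction a x := by
  unfold squareFunction
  have : 0 ≤ ∑ q, ‖a q * squareExt q x‖ ^ 2 := Finset.sum_nonneg fun _ _ => by positivity
  positivity

lemma continuous_sum_squareExt {n : ℕ} (a : Fin n × Fin n → ℂ) (A : Finset (Fin n × Fin n)) :
    Continuous fun x => ∑ q ∈ A, a q * squareExt q x := by fun_prop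

lemma continuous_squareFunction {n : ℕ} (a : Fin n × Fin n → ℂ) :
    Continuous (squareFunction a) := by
  unfold squareFunction
  have : Continuous fun x => ∑ q : Fin n × Fin n, ‖a q * squareExt q x‖ ^ 2 := by fun_prop
  exact this.mul this.sqrt

lemma norm_mul_squareExt_le {n : ℕ} (hn : 1 ≤ n) (a : Fin n × Fin n → ℂ) (q : Fin n × Fin n)
    (x : EuclideanSpace ℝ (Fin 3)) : ‖a q * squareExt q x‖ ≤ ‖a q‖ := by
  rw [norm_mul]
  have hn1 : (1 : ℝ) ≤ n := by exact_mod_cast hn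
  refine mul_le_of_le_one_right (norm_nonneg _) ((norm_squareExt_le q x).trans ?_)
  exact inv_le_one_of_one_le₀ (one_le_pow₀ hn1)

lemma norm_sum_squareExt_le {n : ℕ} (hn : 1 ≤ n) (a : Fin n × Fin n → ℂ)
    (A : Finset (Fin n × Fin n)) (x : EuclideanSpace ℝ (Fin 3)) :
    ‖∑ q ∈ A, a q * squareExt q x‖ ≤ ∑ q ∈ A, ‖a q‖ :=
  (norm_sum_le _ _).trans (Finset.sum_le_sum fun q _ => norm_mul_squareExt_le hn a q x)

lemma integrable_mul_ballWeight {R : ℝ} (hR : 0 < R) (c : EuclideanSpace ℝ (Fin 3))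
    {f : EuclideanSpace ℝ (Fin 3) → ℝ} (hf : Continuous f) {B : ℝ} (hB : ∀ x, ‖f x‖ ≤ B) :
    Integrable fun x => f x * ballWeight c R x :=
  (integrable_ballWeight hR c).bdd_mul hf.aestronglyMeasurable (Filter.Eventually.of_forall hB)

lemma integrable_sum_squareExt_cube {n : ℕ} (hn : 1 ≤ n) (a : Fin n × Fin n → ℂ)
    (A : Finset (Fin n × Fin n)) {R : ℝ} (hR : 0 < R) (c : EuclideanSpace ℝ (Fin 3)) :
    Integrable fun x => ‖∑ q ∈ A, a q * squareExt q x‖ ^ 3 * ballWeight c R x := by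
  refine integrable_mul_ballWeight hR c ((continuous_sum_squareExt a A).norm.pow 3)
    (B := (∑ q ∈ A, ‖a q‖) ^ 3) fun x => ?_
  rw [Real.norm_of_nonneg (by positivity)]
  exact pow_le_pow_left₀ (norm_nonneg _) (norm_sum_squareExt_le hn a A x) 3

lemma integrable_squareFunction {n : ℕ} (hn : 1 ≤ n) (a : Fin n × Fin n → ℂ)
    {R : ℝ} (hR : 0 < R) (c : EuclideanSpace ℝ (Fin 3)) :
    Integrable fun x => squareFunction a x * ballWeight c R x := by
  refine integrable_mul_ballWeight hR c (continuous_squareFunction a)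
    (B := (∑ q, ‖a q‖ ^ 2) * √(∑ q, ‖a q‖ ^ 2)) fun x => ?_
  rw [Real.norm_of_nonneg (squareFunction_nonneg a x)]
  have : ∑ q, ‖a q * squareExt q x‖ ^ 2 ≤ ∑ q, ‖a q‖ ^ 2 :=
    Finset.sum_le_sum fun q _ => pow_le_pow_left₀ (norm_nonneg _) (norm_mul_squareExt_le hn a q x) 2
  have h0 : 0 ≤ ∑ q, ‖a q‖ ^ 2 := Finset.sum_nonneg fun _ _ => by positivity
  exact mul_le_mul this (Real.sqrt_le_sqrt this) (Real.sqrt_nonneg _) h0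

/-- The right side of the averaged decoupling inequality, for a function constant on squares. -/
lemma average_integral_le {n M : ℕ} (hn : 1 ≤ n) (hM : M ∣ n ^ 2)
    {S : Fin M → Finset (Fin n × Fin n)} (hS : IsClassSystem S) (a : Fin n × Fin n → ℂ)
    {L : ℝ} (hL : L = (n : ℝ) ^ 2 / M) {R : ℝ} (hR : 0 < R) (c : EuclideanSpace ℝ (Fin 3)) :
    (1 / ((transversalPartitions S).card : ℝ)) *
          ∑ P ∈ transversalPartitions S, L ^ (1 / 2 : ℝ) *
            ∑ A ∈ P.parts, ∫ x, ‖extensionOp (ensemble A) (stepFun a) x‖ ^ 3 * ballWeight c R x ≤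
      L ^ (1 / 2 : ℝ) * (4 * L⁻¹ ^ 2 * (∫ x, ‖squareSum a x‖ ^ 3 * ballWeight c R x) +
        96 * L * ∫ x, squareFunction a x * ballWeight c R x) := by
  have hL0 : 0 ≤ L := by rw [hL]; positivity
  simp only [extensionOp_ensemble_stepFun]
  have hi := fun A : Finset (Fin n × Fin n) => integrable_sum_squareExt_cube hn a A hR c
  have hD : Integrable fun x => ‖squareSum a x‖ ^ 3 * ballWeight c R x := hi Finset.univ
  have hsum : ∀ P ∈ transversalPartitions S,
      ∑ A ∈ P.parts, ∫ x, ‖∑ q ∈ A, a q * squareExt q x‖ ^ 3 * ballWeight c R x =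
      ∫ x, ∑ A ∈ P.parts, ‖∑ q ∈ A, a q * squareExt q x‖ ^ 3 * ballWeight c R x :=
    fun P _ => (integral_finsetSum _ fun A _ => hi A).symm
  rw [← Finset.mul_sum, Finset.sum_congr rfl hsum,
    ← integral_finsetSum _ fun P _ => integrable_finsetSum _ fun A _ => hi A, mul_left_comm,
    ← integral_const_mul (1 / _), ← integral_const_mul (4 * L⁻¹ ^ 2), ← integral_const_mul (96 * L),
    ← integral_add (hD.const_mul _) ((integrable_squareFunction hn a hR c).const_mul _)]
  refine mul_le_mul_of_nonneg_left (integral_mono ?_ ?_ fun x => ?_) (by positivity)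
  · exact (integrable_finsetSum _ fun P _ => integrable_finsetSum _ fun A _ => hi A).const_mul _
  · exact (hD.const_mul _).add ((integrable_squareFunction hn a hR c).const_mul _)
  · have h := average_transversalPartitions_le hn hM hS (fun q => a q * squareExt q x) hL
    have h2 := mul_le_mul_of_nonneg_right h (ballWeight_nonneg hR c x)
    simp only [← Finset.sum_mul, squareSum, squareFunction]
    refine le_trans (le_of_eq ?_) (h2.trans (le_of_eq ?_)) <;> ring

lemma ofReal_integral_cube_eq {f : EuclideanSpace ℝ (Fin 3) → ℂ}
    {w : EuclideanSpace ℝ (Fin 3) → ℝ} (hw : ∀ x, 0 ≤ w x)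
    (hi : Integrable fun x => ‖f x‖ ^ 3 * w x) :
    ENNReal.ofReal (∫ x, ‖f x‖ ^ 3 * w x) = ∫⁻ x, ‖f x‖ₑ ^ 3 * ENNReal.ofReal (w x) := by
  rw [ofReal_integral_eq_lintegral_ofReal hi
    (Filter.Eventually.of_forall fun x => mul_nonneg (by positivity) (hw x))]
  refine lintegral_congr fun x => ?_
  rw [ENNReal.ofReal_mul (by positivity), ENNReal.ofReal_pow (norm_nonneg _), ofReal_norm]

/-- The self-improved form of the decoupling inequality: a reverse square function estimate. -/
lemma lintegral_ball_squareSum_le {n M : ℕ} (hn : 1 ≤ n) (hM : M ∣ n ^ 2)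
    {S : Fin M → Finset (Fin n × Fin n)} (hS : IsClassSystem S)
    {L R K : ℝ} (hRn : R = (n : ℝ) ^ 2) (hL : L = R / M) (hK : 0 ≤ K)
    (hsmall : ENNReal.ofReal (K * (L ^ (1 / 2 : ℝ) * (4 * L⁻¹ ^ 2))) * weightConst ≤ 1 / 2)
    (hdec : ∀ F : ℝ × ℝ → ℂ, MemLp F ⊤ (volume.restrict unitSquare) →
      ∀ c : EuclideanSpace ℝ (Fin 3),
      ∫ x in Metric.ball c R, ‖extensionOp unitSquare F x‖ ^ 3 ≤
        K * ((1 / ((transversalPartitions S).card : ℝ)) *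
          ∑ P ∈ transversalPartitions S, (R / M) ^ (1 / 2 : ℝ) *
            ∑ A ∈ P.parts, ∫ x, ‖extensionOp (ensemble A) F x‖ ^ 3 * ballWeight c R x))
    (a : Fin n × Fin n → ℂ) {Q : ℝ≥0∞}
    (hQ : ∀ c, ∫⁻ x, ENNReal.ofReal (squareFunction a x * ballWeight c R x) ≤ Q)
    (c : EuclideanSpace ℝ (Fin 3)) :
    ∫⁻ x in Metric.ball c R, ‖squareSum a x‖ₑ ^ 3 ≤
      2 * (ENNReal.ofReal (K * (L ^ (1 / 2 : ℝ) * (96 * L))) * Q) := by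
  have hn1 : (1 : ℝ) ≤ n := by exact_mod_cast hn
  have hR : 0 < R := by rw [hRn]; positivity
  have hL0 : 0 ≤ L := by rw [hL]; positivity
  have hcont : Continuous (squareSum a) := continuous_sum_squareExt a Finset.univ
  have hbd : ∀ x, ‖squareSum a x‖ ≤ ∑ q, ‖a q‖ := norm_sum_squareExt_le hn a Finset.univ
  -- The weight reaches outside the ball, so the inequality does not close on a single ball. It
  -- closes for the supremum over all centres.
  set A : ℝ≥0∞ := ⨆ c, ∫⁻ x in Metric.ball c R, ‖squareSum a x‖ₑ ^ 3 with hA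
  have hcA : ∀ c, ∫⁻ x in Metric.ball c R, ‖squareSum a x‖ₑ ^ 3 ≤ A := fun c => le_iSup
    (fun c => ∫⁻ x in Metric.ball c R, ‖squareSum a x‖ₑ ^ 3) c
  -- A priori finiteness, from boundedness of the sum, is what permits subtracting $A/2$ later.
  have hAt : A ≠ ⊤ := by
    have : A ≤ ENNReal.ofReal ((∑ q, ‖a q‖) ^ 3) *
        volume (Metric.ball (0 : EuclideanSpace ℝ (Fin 3)) R) := by
      refine iSup_le fun c => ?_
      have hv : volume (Metric.ball (0 : EuclideanSpace ℝ (Fin 3)) R) =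
          volume (Metric.ball c R) := (Measure.addHaar_ball_center volume c R).symm
      rw [hv, ← setLIntegral_const]
      refine lintegral_mono fun x => ?_
      rw [ENNReal.ofReal_pow (Finset.sum_nonneg fun _ _ => norm_nonneg _)]
      gcongr
      rw [← ofReal_norm]
      exact ENNReal.ofReal_le_ofReal (hbd x)
    exact ne_top_of_le_ne_top (ENNReal.mul_ne_top ENNReal.ofReal_ne_top measure_ball_lt_top.ne) this
  have hmeas : Measurable fun x => ‖squareSum a x‖ₑ ^ 3 := by
    have := hcont.measurable
    fun_prop
  have step : ∀ c, ∫⁻ x in Metric.ball c R, ‖squareSum a x‖ₑ ^ 3 ≤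
      1 / 2 * A + ENNReal.ofReal (K * (L ^ (1 / 2 : ℝ) * (96 * L))) * Q := by
    intro c
    have h1 := hdec (stepFun a) (memLp_stepFun a) c
    have h2 := average_integral_le hn hM hS a (hRn ▸ hL) hR c
    rw [hL] at h2
    have h3 := h1.trans (mul_le_mul_of_nonneg_left h2 hK)
    rw [← hL] at h3
    have e : ∀ x, extensionOp unitSquare (stepFun a) x = squareSum a x :=
      extensionOp_unitSquare_stepFun hn a
    simp only [e] at h3
    have hloc : ∫⁻ x in Metric.ball c R, ‖squareSum a x‖ₑ ^ 3 =
        ENNReal.ofReal (∫ x in Metric.ball c R, ‖squareSum a x‖ ^ 3) := by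
      rw [ofReal_integral_eq_lintegral_ofReal]
      · refine lintegral_congr fun x => ?_
        rw [ENNReal.ofReal_pow (norm_nonneg _), ofReal_norm]
      · have : Continuous fun x => ‖squareSum a x‖ ^ 3 := by fun_prop
        exact (this.locallyIntegrable.integrableOn_isCompact
          (isCompact_closedBall c R)).mono_set Metric.ball_subset_closedBall
      · exact Filter.Eventually.of_forall fun x => by positivity
    have hD0 : 0 ≤ ∫ x, ‖squareSum a x‖ ^ 3 * ballWeight c R x := integral_nonneg fun x =>
      mul_nonneg (by positivity) (ballWeight_nonneg hR c x)
    have hV0 : 0 ≤ ∫ x, squareFunction a x * ballWeight c R x := integral_nonneg fun x =>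
      mul_nonneg (squareFunction_nonneg a x) (ballWeight_nonneg hR c x)
    rw [hloc]
    refine (ENNReal.ofReal_le_ofReal h3).trans ?_
    have e2 : ∀ X Y : ℝ, K * (L ^ (1 / 2 : ℝ) * (4 * L⁻¹ ^ 2 * X + 96 * L * Y)) =
        (K * (L ^ (1 / 2 : ℝ) * (4 * L⁻¹ ^ 2))) * X + (K * (L ^ (1 / 2 : ℝ) * (96 * L))) * Y := by
      intro X Y; ring
    rw [e2, ENNReal.ofReal_add (by positivity) (by positivity), ENNReal.ofReal_mul (by positivity),
      ENNReal.ofReal_mul (q := ∫ x, squareFunction a x * ballWeight c R x) (by positivity),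
      ofReal_integral_cube_eq (f := squareSum a) (ballWeight_nonneg hR c)
        (integrable_sum_squareExt_cube hn a Finset.univ hR c),
      ofReal_integral_eq_lintegral_ofReal (integrable_squareFunction hn a hR c)
        (Filter.Eventually.of_forall fun x =>
          mul_nonneg (squareFunction_nonneg a x) (ballWeight_nonneg hR c x))]
    refine add_le_add ?_ (mul_le_mul_right (hQ c) _)
    refine (mul_le_mul_right (lintegral_mul_ballWeight_le hmeas hR hcA c) _).trans ?_
    rw [← mul_assoc]
    exact mul_le_mul_left hsmall _
  have hfin : A ≤ 1 / 2 * A + ENNReal.ofReal (K * (L ^ (1 / 2 : ℝ) * (96 * L))) * Q := iSup_le step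
  refine (hcA c).trans ?_
  set Z := ENNReal.ofReal (K * (L ^ (1 / 2 : ℝ) * (96 * L))) * Q
  have h4 : 1 / 2 * A + 1 / 2 * A = A := by
    rw [← add_mul, ENNReal.add_halves, one_mul]
  have h5 : 1 / 2 * A ≤ Z := by
    have : 1 / 2 * A + 1 / 2 * A ≤ 1 / 2 * A + Z := by rw [h4]; exact hfin
    exact (ENNReal.add_le_add_iff_left (by finiteness)).mp this
  calc A = 1 / 2 * A + 1 / 2 * A := h4.symm
    _ ≤ Z + Z := add_le_add h5 h5
    _ = 2 * Z := (two_mul Z).symm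

/-! ### From functions constant on squares to general functions -/

lemma lintegral_cube_le {α : Type*} [MeasurableSpace α] (μ : Measure α) {g : α → ℝ≥0∞}
    (hg : AEMeasurable g μ) : (∫⁻ a, g a ∂μ) ^ 3 ≤ μ Set.univ ^ 2 * ∫⁻ a, g a ^ 3 ∂μ := by
  have h := ENNReal.lintegral_mul_le_Lp_mul_Lq μ
    (Real.holderConjugate_iff.mpr ⟨by norm_num, by norm_num⟩ : (3 : ℝ).HolderConjugate (3 / 2))
    hg (aemeasurable_const (b := (1 : ℝ≥0∞)))
  simp only [Pi.mul_apply, mul_one, ENNReal.one_rpow, lintegral_const, one_mul] at h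
  have e : ∀ x : ℝ≥0∞, x ^ (3 : ℝ) = x ^ 3 := fun x => by
    rw [← ENNReal.rpow_natCast]; norm_num
  simp only [e] at h
  refine (pow_le_pow_left' h 3).trans_eq ?_
  rw [mul_pow, ← ENNReal.rpow_natCast, ← ENNReal.rpow_mul, ← ENNReal.rpow_natCast (_ ^ _),
    ← ENNReal.rpow_mul, ← ENNReal.rpow_natCast (μ Set.univ)]
  norm_num
  ring

/-- Minkowski's inequality for integrals, in `L³`. -/
lemma lintegral_enorm_integral_cube_le {α β : Type*} [MeasurableSpace α] [MeasurableSpace β]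
    {μ : Measure α} {ν : Measure β} [SFinite μ] [SFinite ν] {f : α → β → ℂ}
    (hf : Measurable fun p : α × β => f p.1 p.2) {K : ℝ≥0∞}
    (hK : ∀ᵐ a ∂μ, ∫⁻ x, ‖f a x‖ₑ ^ 3 ∂ν ≤ K) :
    ∫⁻ x, ‖∫ a, f a x ∂μ‖ₑ ^ 3 ∂ν ≤ μ Set.univ ^ 3 * K := by
  calc ∫⁻ x, ‖∫ a, f a x ∂μ‖ₑ ^ 3 ∂ν
      ≤ ∫⁻ x, μ Set.univ ^ 2 * ∫⁻ a, ‖f a x‖ₑ ^ 3 ∂μ ∂ν := by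
        refine lintegral_mono fun x => ?_
        have hx : Measurable fun a => f a x := hf.comp measurable_prodMk_right
        exact (pow_le_pow_left' (enorm_integral_le_lintegral_enorm _) 3).trans
          (lintegral_cube_le μ hx.enorm.aemeasurable)
    _ = μ Set.univ ^ 2 * ∫⁻ a, ∫⁻ x, ‖f a x‖ₑ ^ 3 ∂ν ∂μ := by
        have hf' : Measurable fun p : β × α => f p.2 p.1 :=
          hf.comp (measurable_snd.prodMk measurable_fst)
        have hm' : Measurable fun p : β × α => ‖f p.2 p.1‖ₑ ^ 3 := hf'.enorm.pow_const 3
        rw [lintegral_const_mul _ hm'.lintegral_prod_right', lintegral_lintegral_swap]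
        exact hm'.aemeasurable
    _ ≤ μ Set.univ ^ 2 * ∫⁻ _, K ∂μ := mul_le_mul_right (lintegral_mono_ae hK) _
    _ = _ := by rw [lintegral_const]; ring

lemma add_three_cube_le {a b c : ℝ} (ha : 0 ≤ a) (hb : 0 ≤ b) (hc : 0 ≤ c) :
    (a + b + c) ^ 3 ≤ 9 * (a ^ 3 + b ^ 3 + c ^ 3) := by
  nlinarith [mul_nonneg (add_nonneg ha hb) (sq_nonneg (a - b)),
    mul_nonneg (add_nonneg ha hc) (sq_nonneg (a - c)),
    mul_nonneg (add_nonneg hb hc) (sq_nonneg (b - c)),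
    mul_nonneg ha (sq_nonneg (b - c)), mul_nonneg hb (sq_nonneg (a - c)),
    mul_nonneg hc (sq_nonneg (a - b))]

lemma enorm_add_cube_le (u v : ℂ) : ‖u + v‖ₑ ^ 3 ≤ 4 * ‖u‖ₑ ^ 3 + 4 * ‖v‖ₑ ^ 3 := by
  have h : ‖u + v‖ ^ 3 ≤ 4 * ‖u‖ ^ 3 + 4 * ‖v‖ ^ 3 :=
    (pow_le_pow_left₀ (norm_nonneg _) (norm_add_le u v) 3).trans
      (add_cube_le (norm_nonneg _) (norm_nonneg _))
  have h2 := ENNReal.ofReal_le_ofReal h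
  rwa [ENNReal.ofReal_add (by positivity) (by positivity), ENNReal.ofReal_mul (by norm_num),
    ENNReal.ofReal_mul (by norm_num), ENNReal.ofReal_pow (norm_nonneg _),
    ENNReal.ofReal_pow (norm_nonneg _), ENNReal.ofReal_pow (norm_nonneg _), ofReal_norm,
    ofReal_norm, ofReal_norm, ENNReal.ofReal_ofNat] at h2

/-- The lower left corner of a square. -/
def corner {n : ℕ} (q : Fin n × Fin n) : ℝ × ℝ := ((q.1 : ℝ) / n, (q.2 : ℝ) / n)

/-- The half-open square with side `1/n` at the origin. -/
def baseCell (n : ℕ) : Set (ℝ × ℝ) := Set.Ico 0 (1 / (n : ℝ)) ×ˢ Set.Ico 0 (1 / (n : ℝ))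

lemma measurableSet_baseCell (n : ℕ) : MeasurableSet (baseCell n) :=
  measurableSet_Ico.prod measurableSet_Ico

lemma volume_baseCell (n : ℕ) : volume (baseCell n) = ENNReal.ofReal (((n : ℝ) ^ 2)⁻¹) := by
  rw [baseCell, Measure.volume_eq_prod, Measure.prod_prod, Real.volume_Ico,
    ← ENNReal.ofReal_mul (by simp)]
  congr 1; ring

lemma corner_add_mem_cell {n : ℕ} (q : Fin n × Fin n) (η : ℝ × ℝ) :
    corner q + η ∈ cell q ↔ η ∈ baseCell n := by
  have : ∀ a s : ℝ, (a / n ≤ a / n + s ↔ 0 ≤ s) ∧ (a / n + s < (a + 1) / n ↔ s < 1 / n) := by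
    intro a s
    rw [add_div]
    exact ⟨by simp, by simp⟩
  simp only [corner, cell, baseCell, Set.mem_prod, Set.mem_Ico, Prod.fst_add, Prod.snd_add, this]

lemma setIntegral_cell {n : ℕ} (q : Fin n × Fin n) (f : ℝ × ℝ → ℂ) :
    ∫ ξ in cell q, f ξ = ∫ η in baseCell n, f (corner q + η) := by
  rw [← integral_indicator (measurableSet_cell q), ← integral_indicator (measurableSet_baseCell n),
    ← integral_add_left_eq_self _ (corner q)]
  congr 1
  ext η
  by_cases h : η ∈ baseCell n
  · rw [Set.indicator_of_mem h, Set.indicator_of_mem ((corner_add_mem_cell q η).mpr h)]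
  · rw [Set.indicator_of_notMem h,
      Set.indicator_of_notMem fun h' => h ((corner_add_mem_cell q η).mp h')]

lemma corner_add_mem_unit {n : ℕ} (q : Fin n × Fin n) {η : ℝ × ℝ} (h : η ∈ baseCell n) :
    ‖(((corner q + η).1 : ℝ) : ℂ)‖ ≤ 1 ∧ ‖(((corner q + η).2 : ℝ) : ℂ)‖ ≤ 1 := by
  have hn : 1 ≤ n := q.1.pos
  have h1 : corner q + η ∈ ⋃ p : Fin n × Fin n, cell p :=
    Set.mem_iUnion.mpr ⟨q, (corner_add_mem_cell q η).mpr h⟩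
  rw [iUnion_cell hn, Set.mem_prod, Set.mem_Ico, Set.mem_Ico] at h1
  rw [Complex.norm_real, Complex.norm_real, Real.norm_of_nonneg h1.1.1, Real.norm_of_nonneg h1.2.1]
  exact ⟨h1.1.2.le, h1.2.2.le⟩

/-- An exponential sum with one frequency in each square. -/
def waveSum {n : ℕ} (a : Fin n × Fin n → ℂ) (η : ℝ × ℝ) (x : EuclideanSpace ℝ (Fin 3)) : ℂ :=
  ∑ q, a q * wave (corner q + η) x

lemma continuous_waveSum {n : ℕ} (a : Fin n × Fin n → ℂ) :
    Continuous fun p : (ℝ × ℝ) × EuclideanSpace ℝ (Fin 3) => waveSum a p.1 p.2 := by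
  unfold waveSum
  have hw : ∀ q : Fin n × Fin n, Continuous fun p : (ℝ × ℝ) × EuclideanSpace ℝ (Fin 3) =>
      wave (corner q + p.1) p.2 := fun q =>
    continuous_wave.comp (f := fun p : (ℝ × ℝ) × EuclideanSpace ℝ (Fin 3) =>
      (corner q + p.1, p.2)) (by fun_prop)
  fun_prop

lemma continuous_waveSum_left {n : ℕ} (a : Fin n × Fin n → ℂ) (x : EuclideanSpace ℝ (Fin 3)) :
    Continuous fun η => waveSum a η x :=
  (continuous_waveSum a).comp (f := fun η => (η, x)) (by fun_prop)

lemma continuous_waveSum_right {n : ℕ} (a : Fin n × Fin n → ℂ) (η : ℝ × ℝ) :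
    Continuous (waveSum a η) :=
  (continuous_waveSum a).comp (f := fun x => (η, x)) (by fun_prop)

lemma norm_waveSum_le {n : ℕ} (a : Fin n × Fin n → ℂ) (η : ℝ × ℝ)
    (x : EuclideanSpace ℝ (Fin 3)) : ‖waveSum a η x‖ ≤ ∑ q, ‖a q‖ := by
  refine (norm_sum_le _ _).trans_eq (Finset.sum_congr rfl fun q _ => ?_)
  rw [norm_mul, norm_wave, mul_one]

instance (n : ℕ) : IsFiniteMeasure (volume.restrict (baseCell n)) :=
  ⟨by rw [Measure.restrict_apply_univ, volume_baseCell]; exact ENNReal.ofReal_lt_top⟩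

lemma squareSum_eq_integral {n : ℕ} (a : Fin n × Fin n → ℂ) (x : EuclideanSpace ℝ (Fin 3)) :
    squareSum a x = ∫ η in baseCell n, waveSum a η x := by
  unfold squareSum waveSum
  rw [integral_finsetSum]
  · refine Finset.sum_congr rfl fun q _ => ?_
    rw [integral_const_mul, squareExt, setIntegral_cell]
  · intro q _
    refine Integrable.const_mul (Integrable.of_bound (C := 1) ?_ ?_) _
    · exact (continuous_wave.comp
        ((continuous_const.add continuous_id).prodMk continuous_const)).aestronglyMeasurable
    · exact Filter.Eventually.of_forall fun η => (norm_wave _ x).le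

lemma hasDerivAt_wave (ξ δ : ℝ × ℝ) (x : EuclideanSpace ℝ (Fin 3)) (s : ℝ) :
    HasDerivAt (fun s : ℝ => wave (ξ + s • δ) x)
      (wave (ξ + s • δ) x * (2 * Real.pi * Complex.I * ((δ.1 * x 0 + δ.2 * x 1 +
        2 * ((ξ + s • δ).1 * δ.1 + (ξ + s • δ).2 * δ.2) * x 2 : ℝ) : ℂ))) s := by
  have h1 : HasDerivAt (fun s : ℝ => phase (ξ + s • δ) x) (δ.1 * x 0 + δ.2 * x 1 +
        2 * ((ξ + s • δ).1 * δ.1 + (ξ + s • δ).2 * δ.2) * x 2) s := by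
    have l : ∀ a b : ℝ, HasDerivAt (fun s : ℝ => a + s * b) b s := fun a b => by
      simpa using ((hasDerivAt_id s).mul_const b).const_add a
    have := (((l ξ.1 δ.1).mul_const (x 0)).add ((l ξ.2 δ.2).mul_const (x 1))).add
      ((((l ξ.1 δ.1).pow 2).add ((l ξ.2 δ.2).pow 2)).mul_const (x 2))
    convert! this using 1
    simp only [Prod.fst_add, Prod.snd_add, Prod.smul_fst, Prod.smul_snd, smul_eq_mul]
    push_cast
    ring
  have h2 := ((h1.ofReal_comp.const_mul (2 * Real.pi : ℂ)).mul_const Complex.I).cexp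
  convert! h2 using 1
  simp only [wave]
  ring

/-- The derivative of an exponential sum with respect to the frequency shift. -/
def waveSumDeriv {n : ℕ} (a : Fin n × Fin n → ℂ) (η δ : ℝ × ℝ) (x : EuclideanSpace ℝ (Fin 3)) : ℂ :=
  2 * Real.pi * Complex.I * (((δ.1 * x 0 + δ.2 * x 1 : ℝ) : ℂ) * waveSum a η x +
    ((2 * δ.1 * x 2 : ℝ) : ℂ) * waveSum (fun q => a q * (((corner q + η).1 : ℝ) : ℂ)) η x +
    ((2 * δ.2 * x 2 : ℝ) : ℂ) * waveSum (fun q => a q * (((corner q + η).2 : ℝ) : ℂ)) η x)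

lemma hasDerivAt_waveSum {n : ℕ} (a : Fin n × Fin n → ℂ) (η δ : ℝ × ℝ)
    (x : EuclideanSpace ℝ (Fin 3)) (s : ℝ) :
    HasDerivAt (fun s : ℝ => waveSum a (η + s • δ) x) (waveSumDeriv a (η + s • δ) δ x) s := by
  unfold waveSum
  simp only [← add_assoc]
  have := HasDerivAt.fun_sum (u := Finset.univ) fun q (_ : q ∈ Finset.univ) =>
    (hasDerivAt_wave (corner q + η) δ x s).const_mul (a q)
  convert! this using 1
  rw [waveSumDeriv, waveSum, waveSum, waveSum, Finset.mul_sum, Finset.mul_sum, Finset.mul_sum,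
    ← Finset.sum_add_distrib, ← Finset.sum_add_distrib, Finset.mul_sum]
  refine Finset.sum_congr rfl fun q _ => ?_
  rw [← add_assoc]
  push_cast
  ring

lemma continuous_waveSumDeriv {n : ℕ} (a : Fin n × Fin n → ℂ) (η δ : ℝ × ℝ) :
    Continuous fun p : ℝ × EuclideanSpace ℝ (Fin 3) => waveSumDeriv a (η + p.1 • δ) δ p.2 := by
  unfold waveSumDeriv waveSum
  have hw : ∀ q : Fin n × Fin n, Continuous fun p : ℝ × EuclideanSpace ℝ (Fin 3) =>
      wave (corner q + (η + p.1 • δ)) p.2 := fun q =>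
    continuous_wave.comp (f := fun p : ℝ × EuclideanSpace ℝ (Fin 3) =>
      (corner q + (η + p.1 • δ), p.2)) (by fun_prop)
  fun_prop

/-- The uniform bound for the exponential sums with coefficients in the unit disc. -/
def waveSup (n : ℕ) : ℝ≥0∞ :=
  ⨆ p : {p : (Fin n × Fin n → ℂ) × (ℝ × ℝ) // (∀ q, ‖p.1 q‖ ≤ 1) ∧ p.2 ∈ baseCell n},
    ∫⁻ x in Metric.ball (0 : EuclideanSpace ℝ (Fin 3)) ((n : ℝ) / 100), ‖waveSum p.1.1 p.1.2 x‖ₑ ^ 3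

lemma le_waveSup {n : ℕ} {a : Fin n × Fin n → ℂ} (ha : ∀ q, ‖a q‖ ≤ 1) {η : ℝ × ℝ}
    (hη : η ∈ baseCell n) :
    ∫⁻ x in Metric.ball (0 : EuclideanSpace ℝ (Fin 3)) ((n : ℝ) / 100), ‖waveSum a η x‖ₑ ^ 3 ≤
      waveSup n :=
  le_iSup (fun p : {p : (Fin n × Fin n → ℂ) × (ℝ × ℝ) // (∀ q, ‖p.1 q‖ ≤ 1) ∧ p.2 ∈ baseCell n} =>
    ∫⁻ x in Metric.ball (0 : EuclideanSpace ℝ (Fin 3)) ((n : ℝ) / 100),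
      ‖waveSum p.1.1 p.1.2 x‖ₑ ^ 3) ⟨(a, η), ha, hη⟩

lemma waveSup_ne_top (n : ℕ) : waveSup n ≠ ⊤ := by
  have : waveSup n ≤ ENNReal.ofReal (((n : ℝ) ^ 2) ^ 3) *
      volume (Metric.ball (0 : EuclideanSpace ℝ (Fin 3)) ((n : ℝ) / 100)) := by
    refine iSup_le fun p => ?_
    rw [← setLIntegral_const]
    refine lintegral_mono fun x => ?_
    rw [ENNReal.ofReal_pow (by positivity), ← ofReal_norm]
    gcongr
    refine (norm_waveSum_le _ _ x).trans ((Finset.sum_le_sum fun q _ => p.2.1 q).trans_eq ?_)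
    simp [sq]
  exact ne_top_of_le_ne_top (ENNReal.mul_ne_top ENNReal.ofReal_ne_top measure_ball_lt_top.ne) this

/-- This is where the radius $n/100$ matters: differentiation brings down products $\delta_ix_j$ of
size at most $1/100$. The constants combine to $9\,(6.3/50)^3\le1/48$. -/
lemma enorm_waveSumDeriv_cube_le {n : ℕ} (a : Fin n × Fin n → ℂ) (η : ℝ × ℝ) {δ : ℝ × ℝ}
    (h1 : |δ.1| ≤ 1 / n) (h2 : |δ.2| ≤ 1 / n) {x : EuclideanSpace ℝ (Fin 3)}
    (hx : x ∈ Metric.ball (0 : EuclideanSpace ℝ (Fin 3)) ((n : ℝ) / 100)) :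
    ‖waveSumDeriv a η δ x‖ₑ ^ 3 ≤ ENNReal.ofReal (1 / 48) * (‖waveSum a η x‖ₑ ^ 3 +
      ‖waveSum (fun q => a q * (((corner q + η).1 : ℝ) : ℂ)) η x‖ₑ ^ 3 +
      ‖waveSum (fun q => a q * (((corner q + η).2 : ℝ) : ℂ)) η x‖ₑ ^ 3) := by
  rw [mem_ball_zero_iff] at hx
  have hn0 : (0 : ℝ) < n := by
    by_contra h
    have := norm_nonneg x
    linarith
  have hxi : ∀ i, |x i| ≤ n / 100 := fun i => by
    have := PiLp.norm_apply_le x i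
    rw [Real.norm_eq_abs] at this
    linarith
  have hprod : ∀ (d : ℝ) (i : Fin 3), |d| ≤ 1 / n → |d * x i| ≤ 1 / 100 := by
    intro d i hd
    rw [abs_mul]
    refine (mul_le_mul hd (hxi i) (abs_nonneg _) (by positivity)).trans_eq ?_
    field_simp
  set u := waveSum a η x
  set v := waveSum (fun q => a q * (((corner q + η).1 : ℝ) : ℂ)) η x with hv
  set w := waveSum (fun q => a q * (((corner q + η).2 : ℝ) : ℂ)) η x with hw
  have e1 : ‖((δ.1 * x 0 + δ.2 * x 1 : ℝ) : ℂ)‖ ≤ 1 / 50 := by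
    rw [Complex.norm_real, Real.norm_eq_abs]
    refine (abs_add_le _ _).trans ?_
    linarith [hprod δ.1 0 h1, hprod δ.2 1 h2]
  have e2 : ‖((2 * δ.1 * x 2 : ℝ) : ℂ)‖ ≤ 1 / 50 := by
    rw [Complex.norm_real, Real.norm_eq_abs, mul_assoc, abs_mul, abs_two]
    linarith [hprod δ.1 2 h1]
  have e3 : ‖((2 * δ.2 * x 2 : ℝ) : ℂ)‖ ≤ 1 / 50 := by
    rw [Complex.norm_real, Real.norm_eq_abs, mul_assoc, abs_mul, abs_two]
    linarith [hprod δ.2 2 h2]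
  have epi : ‖(2 * Real.pi * Complex.I : ℂ)‖ ≤ 6.3 := by
    have : ‖(2 * Real.pi * Complex.I : ℂ)‖ = 2 * Real.pi := by simp [abs_of_pos Real.pi_pos]
    rw [this]; linarith [Real.pi_lt_d2]
  have hnorm : ‖waveSumDeriv a η δ x‖ ≤ 0.126 * (‖u‖ + ‖v‖ + ‖w‖) := by
    rw [waveSumDeriv, norm_mul]
    have h3 : ‖((δ.1 * x 0 + δ.2 * x 1 : ℝ) : ℂ) * u + ((2 * δ.1 * x 2 : ℝ) : ℂ) * v +
        ((2 * δ.2 * x 2 : ℝ) : ℂ) * w‖ ≤ 1 / 50 * ‖u‖ + 1 / 50 * ‖v‖ + 1 / 50 * ‖w‖ := by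
      refine (norm_add₃_le).trans ?_
      rw [norm_mul, norm_mul, norm_mul]
      gcongr
    refine (mul_le_mul epi h3 (norm_nonneg _) (by norm_num)).trans_eq ?_
    ring
  have hcube : ‖waveSumDeriv a η δ x‖ ^ 3 ≤ 1 / 48 * (‖u‖ ^ 3 + ‖v‖ ^ 3 + ‖w‖ ^ 3) := by
    have h9 : (‖u‖ + ‖v‖ + ‖w‖) ^ 3 ≤ 9 * (‖u‖ ^ 3 + ‖v‖ ^ 3 + ‖w‖ ^ 3) := by
      exact add_three_cube_le (norm_nonneg _) (norm_nonneg _) (norm_nonneg _)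
    refine (pow_le_pow_left₀ (norm_nonneg _) hnorm 3).trans ?_
    rw [mul_pow]
    nlinarith [pow_nonneg (norm_nonneg u) 3, pow_nonneg (norm_nonneg v) 3,
      pow_nonneg (norm_nonneg w) 3]
  have h4 := ENNReal.ofReal_le_ofReal hcube
  rwa [ENNReal.ofReal_mul (by norm_num), ENNReal.ofReal_add (by positivity) (by positivity),
    ENNReal.ofReal_add (by positivity) (by positivity), ENNReal.ofReal_pow (norm_nonneg _),
    ENNReal.ofReal_pow (norm_nonneg _), ENNReal.ofReal_pow (norm_nonneg _),
    ENNReal.ofReal_pow (norm_nonneg _), ofReal_norm, ofReal_norm, ofReal_norm, ofReal_norm] at h4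

/-- The frequency coordinates produced by differentiation are absorbed into the coefficients, which
stay in the unit disc because the squares lie in $[0,1]^2$. For this reason `waveSup` is a supremum
over all coefficients. -/
lemma lintegral_waveSumDeriv_le {n : ℕ} {a : Fin n × Fin n → ℂ} (ha : ∀ q, ‖a q‖ ≤ 1)
    {η : ℝ × ℝ} (hη : η ∈ baseCell n) {δ : ℝ × ℝ} (h1 : |δ.1| ≤ 1 / n) (h2 : |δ.2| ≤ 1 / n) :
    ∫⁻ x in Metric.ball (0 : EuclideanSpace ℝ (Fin 3)) ((n : ℝ) / 100),
      ‖waveSumDeriv a η δ x‖ₑ ^ 3 ≤ 1 / 16 * waveSup n := by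
  have hm : ∀ b : Fin n × Fin n → ℂ, Measurable fun x => ‖waveSum b η x‖ₑ ^ 3 := fun b =>
    (continuous_waveSum_right b η).measurable.enorm.pow_const 3
  have hmul : ∀ c : Fin n × Fin n → ℂ, (∀ q, ‖c q‖ ≤ 1) → ∀ q, ‖a q * c q‖ ≤ 1 := by
    intro c hc q
    rw [norm_mul]
    exact mul_le_one₀ (ha q) (norm_nonneg _) (hc q)
  calc _ ≤ ∫⁻ x in Metric.ball (0 : EuclideanSpace ℝ (Fin 3)) ((n : ℝ) / 100),
        ENNReal.ofReal (1 / 48) * (‖waveSum a η x‖ₑ ^ 3 +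
        ‖waveSum (fun q => a q * (((corner q + η).1 : ℝ) : ℂ)) η x‖ₑ ^ 3 +
        ‖waveSum (fun q => a q * (((corner q + η).2 : ℝ) : ℂ)) η x‖ₑ ^ 3) :=
        setLIntegral_mono' Metric.isOpen_ball.measurableSet fun x hx =>
          enorm_waveSumDeriv_cube_le a η h1 h2 hx
    _ ≤ ENNReal.ofReal (1 / 48) * (waveSup n + waveSup n + waveSup n) := by
        rw [lintegral_const_mul' _ _ ENNReal.ofReal_ne_top, lintegral_add_right _ (hm _),
          lintegral_add_right _ (hm _)]
        gcongr
        · exact le_waveSup ha hη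
        · exact le_waveSup (hmul _ fun q => (corner_add_mem_unit q hη).1) hη
        · exact le_waveSup (hmul _ fun q => (corner_add_mem_unit q hη).2) hη
    _ = ENNReal.ofReal (1 / 48) * 3 * waveSup n := by ring
    _ = _ := by
        congr 1
        rw [← ENNReal.ofReal_ofNat 3, ← ENNReal.ofReal_mul (by norm_num)]
        rw [show (1 / 48 * 3 : ℝ) = 16⁻¹ by norm_num, ENNReal.ofReal_inv_of_pos (by norm_num),
          ENNReal.ofReal_ofNat, one_div]

/-- The difference is the integral of the derivative along a segment, which stays in the convex base
square, so Minkowski's inequality applies. -/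
lemma lintegral_waveSum_sub_le {n : ℕ} {a : Fin n × Fin n → ℂ} (ha : ∀ q, ‖a q‖ ≤ 1)
    {η η' : ℝ × ℝ} (hη : η ∈ baseCell n) (hη' : η' ∈ baseCell n) :
    ∫⁻ x in Metric.ball (0 : EuclideanSpace ℝ (Fin 3)) ((n : ℝ) / 100),
      ‖waveSum a η' x - waveSum a η x‖ₑ ^ 3 ≤ 1 / 16 * waveSup n := by
  set δ := η' - η with hδ
  have hT : Convex ℝ (baseCell n) := (convex_Ico _ _).prod (convex_Ico _ _)
  have hin : ∀ s ∈ Set.Ioc (0 : ℝ) 1, η + s • δ ∈ baseCell n := fun s hs =>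
    hT.add_smul_sub_mem hη hη' ⟨hs.1.le, hs.2⟩
  have hd : |δ.1| ≤ 1 / n ∧ |δ.2| ≤ 1 / n := by
    have g : ∀ s t : ℝ, s ∈ Set.Ico 0 (1 / (n : ℝ)) → t ∈ Set.Ico 0 (1 / (n : ℝ)) →
        |t - s| ≤ 1 / n := by
      intro s t hs ht
      rw [abs_le]
      constructor <;> linarith [hs.1, hs.2, ht.1, ht.2]
    exact ⟨g _ _ hη.1 hη'.1, g _ _ hη.2 hη'.2⟩
  have hftc : ∀ x, waveSum a η' x - waveSum a η x =
      ∫ s in Set.Ioc (0 : ℝ) 1, waveSumDeriv a (η + s • δ) δ x := by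
    intro x
    rw [← intervalIntegral.integral_of_le zero_le_one,
      intervalIntegral.integral_eq_sub_of_hasDerivAt
        (f := fun s : ℝ => waveSum a (η + s • δ) x) fun s _ => hasDerivAt_waveSum a η δ x s]
    · simp [hδ]
    · exact ((continuous_waveSumDeriv a η δ).comp
        (Continuous.prodMk_left x)).intervalIntegrable _ _
  simp only [hftc]
  have := lintegral_enorm_integral_cube_le (μ := volume.restrict (Set.Ioc (0 : ℝ) 1))
    (ν := volume.restrict (Metric.ball (0 : EuclideanSpace ℝ (Fin 3)) ((n : ℝ) / 100)))
    (f := fun s x => waveSumDeriv a (η + s • δ) δ x) (continuous_waveSumDeriv a η δ).measurable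
    (K := 1 / 16 * waveSup n) ((ae_restrict_iff' measurableSet_Ioc).mpr
      (Filter.Eventually.of_forall fun s hs => lintegral_waveSumDeriv_le ha (hin s hs) hd.1 hd.2))
  simpa using this

/-- Exponential sums are controlled by extensions of functions constant on squares. -/
lemma waveSup_le {n : ℕ} (hn : 1 ≤ n) {Q : ℝ≥0∞}
    (hQ : ∀ a : Fin n × Fin n → ℂ, (∀ q, ‖a q‖ ≤ 1) →
      ∫⁻ x in Metric.ball (0 : EuclideanSpace ℝ (Fin 3)) ((n : ℝ) / 100),
        ‖squareSum a x‖ₑ ^ 3 ≤ Q) :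
    waveSup n ≤ 8 * (ENNReal.ofReal (((n : ℝ) ^ 2) ^ 3) * Q) := by
  have hn0 : (0 : ℝ) < n := by exact_mod_cast hn
  set ν := volume.restrict (Metric.ball (0 : EuclideanSpace ℝ (Fin 3)) ((n : ℝ) / 100)) with hν
  set N : ℝ≥0∞ := ENNReal.ofReal (((n : ℝ) ^ 2) ^ 3) with hN
  have hNc : ‖((n : ℂ) ^ 2)‖ₑ ^ 3 = N := by
    rw [← ofReal_norm, ← ENNReal.ofReal_pow (norm_nonneg _), norm_pow, Complex.norm_natCast]
  -- The error term is $4\cdot\frac1{16}$ of the supremum itself. Absorbing it leaves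
  -- $\frac{16}3NQ\le8NQ$.
  have step : waveSup n ≤ 4 * (N * Q) + 1 / 4 * waveSup n := by
    refine iSup_le fun ⟨⟨a, η'⟩, ha, hη'⟩ => ?_
    dsimp only at ha hη' ⊢
    have hint : ∀ x, IntegrableOn (fun η => waveSum a η x) (baseCell n) := fun x =>
      Integrable.of_bound (continuous_waveSum_left a x).aestronglyMeasurable (∑ q, ‖a q‖)
        (Filter.Eventually.of_forall fun η => norm_waveSum_le a η x)
    -- Since $n^2$ is the reciprocal of the area of the base square, this writes the sum at $\eta'$
    -- as its mean over all shifts plus the mean deviation.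
    have hsplit : ∀ x, waveSum a η' x = (n : ℂ) ^ 2 * squareSum a x +
        (n : ℂ) ^ 2 * ∫ η in baseCell n, (waveSum a η' x - waveSum a η x) := by
      intro x
      rw [integral_sub (integrable_const _) (hint x), squareSum_eq_integral, setIntegral_const,
        Measure.real, volume_baseCell, ENNReal.toReal_ofReal (by positivity), Complex.real_smul]
      push_cast
      have : (n : ℂ) ≠ 0 := by exact_mod_cast hn0.ne'
      field_simp
      ring
    have hsq : Measurable fun x => ‖squareSum a x‖ₑ ^ 3 :=
      ((continuous_sum_squareExt a Finset.univ).measurable.enorm.pow_const 3)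
    have hmd : Measurable fun p : (ℝ × ℝ) × EuclideanSpace ℝ (Fin 3) =>
        waveSum a η' p.2 - waveSum a p.1 p.2 :=
      (((continuous_waveSum_right a η').comp continuous_snd).sub (continuous_waveSum a)).measurable
    have hmink := lintegral_enorm_integral_cube_le (μ := volume.restrict (baseCell n)) (ν := ν)
      (f := fun η x => waveSum a η' x - waveSum a η x) hmd
      (K := 1 / 16 * waveSup n) ((ae_restrict_iff' (measurableSet_baseCell n)).mpr
        (Filter.Eventually.of_forall fun η hη => lintegral_waveSum_sub_le ha hη hη'))
    rw [Measure.restrict_apply_univ, volume_baseCell] at hmink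
    calc ∫⁻ x, ‖waveSum a η' x‖ₑ ^ 3 ∂ν
        ≤ ∫⁻ x, (4 * N * ‖squareSum a x‖ₑ ^ 3 +
          4 * N * ‖∫ η in baseCell n, (waveSum a η' x - waveSum a η x)‖ₑ ^ 3) ∂ν := by
          refine lintegral_mono fun x => ?_
          have h3 := enorm_add_cube_le ((n : ℂ) ^ 2 * squareSum a x)
            ((n : ℂ) ^ 2 * ∫ η in baseCell n, (waveSum a η' x - waveSum a η x))
          rw [← hsplit x] at h3
          refine h3.trans_eq ?_
          rw [enorm_mul, enorm_mul, mul_pow, mul_pow, hNc]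
          ring
      _ ≤ 4 * N * Q + 4 * N * (ENNReal.ofReal (((n : ℝ) ^ 2)⁻¹) ^ 3 * (1 / 16 * waveSup n)) := by
          rw [lintegral_add_left (hsq.const_mul _), lintegral_const_mul _ hsq,
            lintegral_const_mul' _ _ (by finiteness)]
          gcongr
          exact hQ a ha
      _ = _ := by
          have : N * ENNReal.ofReal (((n : ℝ) ^ 2)⁻¹) ^ 3 = 1 := by
            rw [hN, ← ENNReal.ofReal_pow (by positivity), ← ENNReal.ofReal_mul (by positivity),
              ← mul_pow, mul_inv_cancel₀ (by positivity)]
            simp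
          have h16 : (4 : ℝ≥0∞) * (1 / 16) = 1 / 4 := by
            rw [← ENNReal.toReal_eq_toReal_iff' (by finiteness) (by finiteness)]
            simp; norm_num
          calc _ = 4 * (N * Q) + (N * ENNReal.ofReal (((n : ℝ) ^ 2)⁻¹) ^ 3) *
                (4 * (1 / 16) * waveSup n) := by ring
            _ = _ := by rw [this, h16, one_mul]
  have hA := waveSup_ne_top n
  rcases eq_or_ne Q ⊤ with hQt | hQt
  · have : N ≠ 0 := by
      rw [hN, Ne, ENNReal.ofReal_eq_zero, not_le]; positivity
    rw [hQt, ENNReal.mul_top this, ENNReal.mul_top (by norm_num)]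
    exact le_top
  have hNt : N ≠ ⊤ := ENNReal.ofReal_ne_top
  have hst := ENNReal.toReal_mono (by finiteness) step
  rw [ENNReal.toReal_add (by finiteness) (by finiteness), ENNReal.toReal_mul, ENNReal.toReal_mul,
    ENNReal.toReal_mul (a := 1 / 4)] at hst
  rw [← ENNReal.toReal_le_toReal hA (by finiteness), ENNReal.toReal_mul, ENNReal.toReal_mul]
  have hnn : 0 ≤ N.toReal * Q.toReal := by positivity
  norm_num at hst ⊢
  linarith

/-- For each fixed shift $\eta$, an arbitrary $F$ only supplies one coefficient per square, so
bounds uniform in the coefficients apply slice by slice. -/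
lemma extensionOp_unitSquare_eq_integral {n : ℕ} (hn : 1 ≤ n) {F : ℝ × ℝ → ℂ} (hF : Measurable F)
    (hF1 : ∀ ξ, ‖F ξ‖ ≤ 1) (x : EuclideanSpace ℝ (Fin 3)) :
    extensionOp unitSquare F x =
      ∫ η in baseCell n, waveSum (fun q : Fin n × Fin n => F (corner q + η)) η x := by
  have hb : ∀ ξ, ‖F ξ * wave ξ x‖ ≤ 1 := fun ξ => by
    rw [norm_mul, norm_wave, mul_one]; exact hF1 ξ
  have hm : Measurable fun ξ => F ξ * wave ξ x :=
    hF.mul (continuous_wave.comp (Continuous.prodMk_left x)).measurable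
  have h1 : extensionOp unitSquare F x = ∫ ξ in ⋃ q : Fin n × Fin n, cell q, F ξ * wave ξ x :=
    setIntegral_congr_set (iUnion_cell_ae_eq_unitSquare hn).symm
  rw [h1, integral_iUnion_fintype measurableSet_cell pairwise_disjoint_cell]
  · unfold waveSum
    rw [integral_finsetSum]
    · exact Finset.sum_congr rfl fun q _ => setIntegral_cell q _
    · intro q _
      exact Integrable.of_bound (hm.comp (measurable_const_add _)).aestronglyMeasurable 1
        (Filter.Eventually.of_forall fun η => hb _)
  · intro q
    exact Integrable.of_bound hm.aestronglyMeasurable 1 (Filter.Eventually.of_forall hb)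

/-- On a ball of radius comparable to `n`, the extension operator is controlled by its values at
functions that are constant on the `1/n`-squares. -/
lemma lintegral_extensionOp_le {n : ℕ} (hn : 1 ≤ n) {Q : ℝ≥0∞}
    (hQ : ∀ a : Fin n × Fin n → ℂ, (∀ q, ‖a q‖ ≤ 1) →
      ∫⁻ x in Metric.ball (0 : EuclideanSpace ℝ (Fin 3)) ((n : ℝ) / 100),
        ‖squareSum a x‖ₑ ^ 3 ≤ Q)
    {F : ℝ × ℝ → ℂ} (hF : Measurable F) (hF1 : ∀ ξ, ‖F ξ‖ ≤ 1) :
    ∫⁻ x in Metric.ball (0 : EuclideanSpace ℝ (Fin 3)) ((n : ℝ) / 100),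
      ‖extensionOp unitSquare F x‖ₑ ^ 3 ≤ 8 * Q := by
  have hn0 : (0 : ℝ) < n := by exact_mod_cast hn
  simp only [extensionOp_unitSquare_eq_integral hn hF hF1]
  have hm : Measurable fun p : (ℝ × ℝ) × EuclideanSpace ℝ (Fin 3) =>
      waveSum (fun q : Fin n × Fin n => F (corner q + p.1)) p.1 p.2 := by
    unfold waveSum
    refine Finset.measurable_fun_sum _ fun q _ => ?_
    exact (hF.comp (by fun_prop)).mul (continuous_wave.comp
      ((continuous_const.add continuous_fst).prodMk continuous_snd)).measurable
  have hmink := lintegral_enorm_integral_cube_le (μ := volume.restrict (baseCell n))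
    (ν := volume.restrict (Metric.ball (0 : EuclideanSpace ℝ (Fin 3)) ((n : ℝ) / 100)))
    (f := fun η x => waveSum (fun q : Fin n × Fin n => F (corner q + η)) η x) hm
    (K := waveSup n) ((ae_restrict_iff' (measurableSet_baseCell n)).mpr
      (Filter.Eventually.of_forall fun η hη => le_waveSup (fun q => hF1 _) hη))
  rw [Measure.restrict_apply_univ, volume_baseCell] at hmink
  refine hmink.trans ((mul_le_mul_right (waveSup_le hn hQ) _).trans_eq ?_)
  have : ENNReal.ofReal (((n : ℝ) ^ 2)⁻¹) ^ 3 * ENNReal.ofReal (((n : ℝ) ^ 2) ^ 3) = 1 := by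
    rw [← ENNReal.ofReal_pow (by positivity), ← ENNReal.ofReal_mul (by positivity),
      ← mul_pow, inv_mul_cancel₀ (by positivity)]
    simp
  calc _ = 8 * ((ENNReal.ofReal (((n : ℝ) ^ 2)⁻¹) ^ 3 * ENNReal.ofReal (((n : ℝ) ^ 2) ^ 3)) * Q) := by
        ring
    _ = _ := by rw [this, one_mul]

/-! ### Reduction to normalised functions and centred balls -/

/-- Slicing uses the values of $F$ at individual points, so the bound must hold everywhere and not
only almost everywhere. -/
lemma exists_measurable_bounded_ae_eq {F : ℝ × ℝ → ℂ} {μ : Measure (ℝ × ℝ)} (hF : MemLp F ⊤ μ) :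
    ∃ G : ℝ × ℝ → ℂ, Measurable G ∧ (∀ ξ, ‖G ξ‖ ≤ (eLpNorm F ⊤ μ).toReal) ∧ F =ᵐ[μ] G := by
  set N := (eLpNorm F ⊤ μ).toReal with hN
  set g := hF.1.mk F with hg
  have hgm : Measurable g := hF.1.stronglyMeasurable_mk.measurable
  have hs : MeasurableSet {ξ | ‖g ξ‖ ≤ N} := measurableSet_le hgm.norm measurable_const
  refine ⟨{ξ | ‖g ξ‖ ≤ N}.indicator g, hgm.indicator hs, fun ξ => ?_, ?_⟩
  · by_cases h : ‖g ξ‖ ≤ N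
    · rw [Set.indicator_of_mem (by exact h)]; exact h
    · rw [Set.indicator_of_notMem (by exact h), norm_zero]; exact ENNReal.toReal_nonneg
  · filter_upwards [hF.1.ae_eq_mk, ae_le_eLpNormEssSup (f := F) (μ := μ)] with ξ h1 h2
    have h3 : ‖F ξ‖ ≤ N := by
      rw [← eLpNorm_exponent_top] at h2
      have := ENNReal.toReal_mono hF.2.ne h2
      rwa [toReal_enorm] at this
    rw [h1] at h3
    rw [Set.indicator_of_mem (by exact h3)]
    exact h1

lemma extensionOp_congr_ae {S : Set (ℝ × ℝ)} {F G : ℝ × ℝ → ℂ} (h : F =ᵐ[volume.restrict S] G)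
    (x : EuclideanSpace ℝ (Fin 3)) : extensionOp S F x = extensionOp S G x := by
  refine integral_congr_ae ?_
  filter_upwards [h] with ξ hξ
  rw [hξ]

lemma extensionOp_add (S : Set (ℝ × ℝ)) (F : ℝ × ℝ → ℂ) (x c : EuclideanSpace ℝ (Fin 3)) :
    extensionOp S F (x + c) = extensionOp S (fun ξ => F ξ * wave ξ c) x := by
  have : ∀ ξ, F ξ * wave ξ (x + c) = F ξ * wave ξ c * wave ξ x := fun ξ => by
    rw [wave_add]; ring
  exact integral_congr_ae (Filter.Eventually.of_forall this)

lemma extensionOp_const_mul (S : Set (ℝ × ℝ)) (F : ℝ × ℝ → ℂ) (z : ℂ)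
    (x : EuclideanSpace ℝ (Fin 3)) :
    extensionOp S (fun ξ => z * F ξ) x = z * extensionOp S F x := by
  unfold extensionOp
  rw [← integral_const_mul]
  simp only [mul_assoc]

/-- The localised estimate on balls with arbitrary centre, and for functions of any size. -/
lemma lintegral_ball_extensionOp_le {n : ℕ} (hn : 1 ≤ n) {Q : ℝ≥0∞}
    (hQ : ∀ a : Fin n × Fin n → ℂ, (∀ q, ‖a q‖ ≤ 1) →
      ∫⁻ x in Metric.ball (0 : EuclideanSpace ℝ (Fin 3)) ((n : ℝ) / 100),
        ‖squareSum a x‖ₑ ^ 3 ≤ Q)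
    {F : ℝ × ℝ → ℂ} (hF : Measurable F) {N : ℝ} (hFN : ∀ ξ, ‖F ξ‖ ≤ N)
    (c : EuclideanSpace ℝ (Fin 3)) :
    ∫⁻ x in Metric.ball c ((n : ℝ) / 100), ‖extensionOp unitSquare F x‖ₑ ^ 3 ≤
      ENNReal.ofReal (N ^ 3) * (8 * Q) := by
  have hN : 0 ≤ N := (norm_nonneg _).trans (hFN 0)
  rcases eq_or_lt_of_le hN with h0 | h0
  · have hF0 : F = 0 := funext fun ξ => norm_le_zero_iff.mp (h0 ▸ hFN ξ)
    have : ∀ x, extensionOp unitSquare F x = 0 := fun x => by simp [extensionOp, hF0]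
    simp [this]
  -- Modulating by the wave at `c` moves the centre of the ball to the origin, and dividing by `N`
  -- normalises the size.
  set G : ℝ × ℝ → ℂ := fun ξ => (N : ℂ)⁻¹ * (F ξ * wave ξ c) with hG
  have hGm : Measurable G :=
    (hF.mul (continuous_wave.comp (Continuous.prodMk_left c)).measurable).const_mul _
  have hG1 : ∀ ξ, ‖G ξ‖ ≤ 1 := by
    intro ξ
    rw [hG]
    simp only [norm_mul, norm_inv, Complex.norm_real, norm_wave, mul_one]
    rw [Real.norm_of_nonneg hN, inv_mul_le_iff₀ h0, mul_one]
    exact hFN ξ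
  have key := lintegral_extensionOp_le hn hQ hGm hG1
  have hEG : ∀ x, extensionOp unitSquare F (x + c) = N * extensionOp unitSquare G x := by
    intro x
    rw [hG, extensionOp_const_mul, extensionOp_add, mul_inv_cancel_left₀]
    exact_mod_cast h0.ne'
  have hNe : ‖(N : ℂ)‖ₑ ^ 3 = ENNReal.ofReal (N ^ 3) := by
    rw [← ofReal_norm, Complex.norm_real, Real.norm_of_nonneg hN, ENNReal.ofReal_pow hN]
  calc ∫⁻ x in Metric.ball c ((n : ℝ) / 100), ‖extensionOp unitSquare F x‖ₑ ^ 3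
      = ∫⁻ x in Metric.ball (0 : EuclideanSpace ℝ (Fin 3)) ((n : ℝ) / 100),
          ‖extensionOp unitSquare F (x + c)‖ₑ ^ 3 := by
        rw [← lintegral_indicator Metric.isOpen_ball.measurableSet,
          ← lintegral_indicator Metric.isOpen_ball.measurableSet,
          ← lintegral_add_right_eq_self _ c]
        refine lintegral_congr fun x => ?_
        have : x + c ∈ Metric.ball c ((n : ℝ) / 100) ↔ x ∈ Metric.ball 0 ((n : ℝ) / 100) := by
          simp
        by_cases h : x ∈ Metric.ball (0 : EuclideanSpace ℝ (Fin 3)) ((n : ℝ) / 100)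
        · rw [Set.indicator_of_mem h, Set.indicator_of_mem (this.mpr h)]
        · rw [Set.indicator_of_notMem h, Set.indicator_of_notMem fun h' => h (this.mp h')]
    _ = ∫⁻ x in Metric.ball (0 : EuclideanSpace ℝ (Fin 3)) ((n : ℝ) / 100),
          ENNReal.ofReal (N ^ 3) * ‖extensionOp unitSquare G x‖ₑ ^ 3 := by
        refine lintegral_congr fun x => ?_
        rw [hEG, enorm_mul, mul_pow, hNe]
    _ = ENNReal.ofReal (N ^ 3) * ∫⁻ x in Metric.ball (0 : EuclideanSpace ℝ (Fin 3)) ((n : ℝ) / 100),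
          ‖extensionOp unitSquare G x‖ₑ ^ 3 := lintegral_const_mul' _ _ ENNReal.ofReal_ne_top
    _ ≤ _ := mul_le_mul_right key _

/-! ### Choice of parameters and conclusion -/

/-- A power of two that is an admissible number of classes. -/
lemma exists_dvd_of_pow_two {γ : ℝ} (hγ : 0 < γ) (hγ1 : γ ≤ 1) (k : ℕ) {R : ℝ}
    (hR : R = ((2 ^ k : ℕ) : ℝ) ^ 2) :
    ∃ M : ℕ, M ∣ (2 ^ k) ^ 2 ∧ R ^ (1 - γ) / 2 ≤ M ∧ M ≤ 2 * R ^ (1 - γ) ∧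
      R ^ γ ≤ R / M ∧ R / M ≤ 2 * R ^ γ := by
  have hR2 : R = 2 ^ (k * 2) := by rw [hR]; push_cast; rw [← pow_mul]
  have hR1 : 1 ≤ R := by rw [hR2]; exact one_le_pow₀ (by norm_num)
  have hR0 : 0 < R := by linarith
  have hX1 : 1 ≤ R ^ (1 - γ) := Real.one_le_rpow hR1 (by linarith)
  -- $M=2^j$ is the largest power of two not exceeding $R^{1-\gamma}$. It divides $R$ because $R$ is
  -- itself a power of two.
  obtain ⟨j, hj1, hj2⟩ := exists_nat_pow_near hX1 (one_lt_two : (1 : ℝ) < 2)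
  have hXR : R ^ (1 - γ) * R ^ γ = R := by
    rw [← Real.rpow_add hR0]; simp
  have hXle : R ^ (1 - γ) ≤ R := by
    nth_rewrite 2 [← Real.rpow_one R]
    exact Real.rpow_le_rpow_of_exponent_le hR1 (by linarith)
  have hjk : j ≤ k * 2 := by
    have : (2 : ℝ) ^ j ≤ 2 ^ (k * 2) := by rw [← hR2]; exact hj1.trans hXle
    exact (pow_le_pow_iff_right₀ (by norm_num)).mp this
  have hγ0 : 0 < R ^ γ := by positivity
  rw [pow_succ] at hj2
  have hM0 : (0 : ℝ) < 2 ^ j := by positivity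
  refine ⟨2 ^ j, ?_, ?_, ?_, ?_, ?_⟩
  · rw [← pow_mul]; exact pow_dvd_pow 2 hjk
  · push_cast; linarith
  · push_cast; linarith
  · push_cast
    rw [le_div_iff₀ hM0]
    nlinarith
  · push_cast
    rw [div_le_iff₀ hM0]
    nlinarith

/-- The reverse square function estimate, for functions constant on squares and bounded by one. -/
lemma exists_lintegral_squareSum_le {S : ∀ n M : ℕ, Fin M → Finset (Fin n × Fin n)}
    (hS : ∀ n M : ℕ, 1 ≤ n → M ∣ n ^ 2 → IsClassSystem (S n M))
    {γ : ℝ} (hγ : 0 < γ) (hγ1 : γ ≤ 1) (hdec : AveragedDecoupling S γ) :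
    ∃ (n₀ : ℝ) (C : ℝ), 0 ≤ C ∧ ∀ k : ℕ, n₀ ≤ (2 ^ k : ℕ) →
      ∀ a : Fin (2 ^ k) × Fin (2 ^ k) → ℂ, (∀ q, ‖a q‖ ≤ 1) → ∀ c : EuclideanSpace ℝ (Fin 3),
        ∫⁻ x in Metric.ball c (((2 ^ k : ℕ) : ℝ) ^ 2), ‖squareSum a x‖ₑ ^ 3 ≤
          ENNReal.ofReal (C * (((2 ^ k : ℕ) : ℝ) ^ 2) ^ (4 * γ)) := by
  -- Decoupling is used with loss $R^\gamma$, which is beaten by the gain $L^{-3/2}\le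
  -- R^{-3\gamma/2}$. The constant is then replaced by `max C 0`, since its sign is unknown.
  obtain ⟨C, hC⟩ := hdec γ hγ
  set C' := max C 0 with hC'
  have hC'0 : 0 ≤ C' := le_max_right _ _
  set W := weightConst.toReal with hW
  have hW0 : 0 ≤ W := ENNReal.toReal_nonneg
  set Z := (squareFunctionConst γ).toReal with hZ
  have hZ0 : 0 ≤ Z := ENNReal.toReal_nonneg
  -- Beyond this threshold the net gain $R^{-\gamma/2}$ also beats the constants. The threshold is
  -- for $R$, but requiring it of $n\le R$ suffices.
  obtain ⟨n₀, hn₀⟩ := Filter.eventually_atTop.mp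
    ((tendsto_rpow_atTop (by positivity : 0 < γ / 2)).eventually_ge_atTop (8 * C' * W))
  refine ⟨n₀, 2 * (C' * (3 * 96)) * Z, by positivity, fun k hk => ?_⟩
  obtain ⟨M, hMd, hM1, hM2, hL1, hL2⟩ := exists_dvd_of_pow_two hγ hγ1 k rfl
  have hn1 : 1 ≤ 2 ^ k := Nat.one_le_two_pow
  generalize 2 ^ k = n at hk hMd hM1 hM2 hL1 hL2 hn1 ⊢
  intro a ha c
  have hn1' : (1 : ℝ) ≤ n := by exact_mod_cast hn1
  set R := (n : ℝ) ^ 2 with hR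
  have hR1 : 1 ≤ R := one_le_pow₀ hn1'
  have hR0 : 0 < R := by linarith
  set L := R / M with hL
  have hRγ : 0 < R ^ γ := by positivity
  have hL0 : 0 < L := hRγ.trans_le hL1
  set K := C' * R ^ γ with hK
  have hK0 : 0 ≤ K := by positivity
  have hLpow : L ^ (1 / 2 : ℝ) * L = L ^ (3 / 2 : ℝ) := by
    rw [← Real.rpow_add_one hL0.ne']; norm_num
  have hLpow' : L ^ (1 / 2 : ℝ) * L⁻¹ ^ 2 = L ^ (-(3 / 2) : ℝ) := by
    rw [inv_pow, ← Real.rpow_natCast, ← Real.rpow_neg hL0.le, ← Real.rpow_add hL0]; norm_num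
  have hsmallR : K * (L ^ (1 / 2 : ℝ) * (4 * L⁻¹ ^ 2)) * W ≤ 1 / 2 := by
    have h1 : L ^ (-(3 / 2) : ℝ) ≤ (R ^ γ) ^ (-(3 / 2) : ℝ) :=
      Real.rpow_le_rpow_of_nonpos hRγ hL1 (by norm_num)
    have h2 : R ^ γ * (R ^ γ) ^ (-(3 / 2) : ℝ) = (R ^ (γ / 2))⁻¹ := by
      rw [← Real.rpow_mul hR0.le, ← Real.rpow_add hR0, ← Real.rpow_neg hR0.le]
      congr 1; ring
    have h3 : 8 * C' * W ≤ R ^ (γ / 2) := hn₀ R (hk.trans (by rw [hR]; nlinarith))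
    have h4 : 0 < R ^ (γ / 2) := by positivity
    calc K * (L ^ (1 / 2 : ℝ) * (4 * L⁻¹ ^ 2)) * W
        = 4 * C' * W * (R ^ γ * (L ^ (1 / 2 : ℝ) * L⁻¹ ^ 2)) := by rw [hK]; ring
      _ ≤ 4 * C' * W * (R ^ γ * (R ^ γ) ^ (-(3 / 2) : ℝ)) := by rw [hLpow']; gcongr
      _ = (4 * C' * W) / R ^ (γ / 2) := by rw [h2]; rfl
      _ ≤ 1 / 2 := by rw [div_le_div_iff₀ h4 (by norm_num)]; linarith
  have hsmall : ENNReal.ofReal (K * (L ^ (1 / 2 : ℝ) * (4 * L⁻¹ ^ 2))) * weightConst ≤ 1 / 2 := by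
    rw [← ENNReal.ofReal_toReal weightConst_ne_top, ← ENNReal.ofReal_mul (by positivity)]
    refine (ENNReal.ofReal_le_ofReal hsmallR).trans_eq ?_
    rw [one_div, ENNReal.ofReal_inv_of_pos (by norm_num), ENNReal.ofReal_ofNat, one_div]
  have hineq : ∀ F : ℝ × ℝ → ℂ, MemLp F ⊤ (volume.restrict unitSquare) →
      ∀ c : EuclideanSpace ℝ (Fin 3),
      ∫ x in Metric.ball c R, ‖extensionOp unitSquare F x‖ ^ 3 ≤
        K * ((1 / ((transversalPartitions (S n M)).card : ℝ)) *
          ∑ P ∈ transversalPartitions (S n M), (R / M) ^ (1 / 2 : ℝ) *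
            ∑ A ∈ P.parts, ∫ x, ‖extensionOp (ensemble A) F x‖ ^ 3 * ballWeight c R x) := by
    intro F hF c
    refine (hC n M R hn1 hR hMd hM1 hM2 F hF c).trans ?_
    rw [hK]
    refine mul_le_mul_of_nonneg_right (by gcongr; exact le_max_left _ _) ?_
    refine mul_nonneg (by positivity) (Finset.sum_nonneg fun P _ =>
      mul_nonneg (by positivity) (Finset.sum_nonneg fun A _ => integral_nonneg fun x => ?_))
    exact mul_nonneg (by positivity) (ballWeight_nonneg hR0 c x)
  have hQ : ∀ c, ∫⁻ x, ENNReal.ofReal (squareFunction a x * ballWeight c R x) ≤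
      squareFunctionConst γ * ENNReal.ofReal (R ^ γ) :=
    fun c => lintegral_squareFunction_le hγ hn1 ha c
  refine (lintegral_ball_squareSum_le hn1 hMd (hS n M hn1 hMd) hR hL hK0 hsmall hineq a hQ
    c).trans ?_
  rw [← ENNReal.ofReal_toReal (squareFunctionConst_ne_top hγ), ← hZ,
    ← ENNReal.ofReal_mul hZ0, ← ENNReal.ofReal_mul (by positivity), ← ENNReal.ofReal_ofNat 2,
    ← ENNReal.ofReal_mul (by norm_num)]
  apply ENNReal.ofReal_le_ofReal
  -- Exponent count: $\gamma$ from decoupling, at most $2\gamma$ from $L^{3/2}$ and $\gamma$ from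
  -- the square function, in total $4\gamma$.
  have h1 : L ^ (3 / 2 : ℝ) ≤ 3 * R ^ (2 * γ) := by
    have h2 : L ^ (3 / 2 : ℝ) ≤ (2 * R ^ γ) ^ (3 / 2 : ℝ) := by gcongr
    rw [Real.mul_rpow (by norm_num) hRγ.le, ← Real.rpow_mul hR0.le] at h2
    have h3 : (2 : ℝ) ^ (3 / 2 : ℝ) ≤ 3 := by
      rw [show (3 / 2 : ℝ) = 1 + 1 / 2 by norm_num, Real.rpow_add (by norm_num), Real.rpow_one,
        ← Real.sqrt_eq_rpow]
      have : √2 ≤ 3 / 2 := by rw [Real.sqrt_le_left (by norm_num)]; norm_num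
      linarith
    have h4 : R ^ (γ * (3 / 2)) ≤ R ^ (2 * γ) :=
      Real.rpow_le_rpow_of_exponent_le hR1 (by linarith)
    exact h2.trans (mul_le_mul h3 h4 (by positivity) (by norm_num))
  have h5 : R ^ γ * R ^ (2 * γ) * R ^ γ = R ^ (4 * γ) := by
    rw [← Real.rpow_add hR0, ← Real.rpow_add hR0]; congr 1; ring
  calc 2 * (K * (L ^ (1 / 2 : ℝ) * (96 * L)) * (Z * R ^ γ))
      = 2 * (C' * 96) * Z * (R ^ γ * L ^ (3 / 2 : ℝ) * R ^ γ) := by rw [← hLpow, hK]; ring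
    _ ≤ 2 * (C' * 96) * Z * (R ^ γ * (3 * R ^ (2 * γ)) * R ^ γ) := by gcongr
    _ = 2 * (C' * (3 * 96)) * Z * R ^ (4 * γ) := by rw [← h5]; ring

lemma setIntegral_le_of_lintegral_le {f : EuclideanSpace ℝ (Fin 3) → ℂ}
    {s : Set (EuclideanSpace ℝ (Fin 3))} {B : ℝ} (hB : 0 ≤ B)
    (h : ∫⁻ x in s, ‖f x‖ₑ ^ 3 ≤ ENNReal.ofReal B) : ∫ x in s, ‖f x‖ ^ 3 ≤ B := by
  by_cases hi : Integrable (fun x => ‖f x‖ ^ 3) (volume.restrict s)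
  · rw [← ENNReal.ofReal_le_ofReal_iff hB, ofReal_integral_eq_lintegral_ofReal hi
      (Filter.Eventually.of_forall fun x => by positivity)]
    refine le_trans (le_of_eq (lintegral_congr fun x => ?_)) h
    rw [ENNReal.ofReal_pow (norm_nonneg _), ofReal_norm]
  -- The integral of a non-integrable function is 0 by convention.
  · rw [integral_undef hi]; exact hB

/-- Averaged decoupling implies the restriction conjecture. -/
theorem restrictionConjecture_of_averagedDecoupling
    (S : ∀ n M : ℕ, Fin M → Finset (Fin n × Fin n))
    (hS : ∀ n M : ℕ, 1 ≤ n → M ∣ n ^ 2 → IsClassSystem (S n M))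
    (γ₀ : ℝ) (hγ₀ : 0 < γ₀)
    (hdec : ∀ γ : ℝ, 0 < γ → γ < γ₀ → AveragedDecoupling S γ) :
    RestrictionConjecture := by
  intro ε hε
  -- The three bounds keep $\gamma$ below $\gamma_0$, make $R^{1-\gamma}\ge1$, and keep the final
  -- loss $4\gamma$ below $\varepsilon$.
  set γ := min (min (γ₀ / 2) 1) (ε / 4) with hγdef
  have hγ : 0 < γ := by positivity
  have hγ1 : γ ≤ 1 := (min_le_left _ _).trans (min_le_right _ _)
  have hγε : 4 * γ ≤ ε := by have : γ ≤ ε / 4 := min_le_right _ _; linarith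
  have hγ2 : γ < γ₀ := by
    have : γ ≤ γ₀ / 2 := (min_le_left _ _).trans (min_le_left _ _)
    linarith
  obtain ⟨n₀, C, hC0, hC⟩ := exists_lintegral_squareSum_le hS hγ hγ1 (hdec γ hγ hγ2)
  -- The scale $n$ will be a power of two between $m\sqrt R$ and $2m\sqrt R$. The factor $m$ ensures
  -- both $n/100\ge\sqrt R$ and $n\ge n_0$ for every $R\ge1$, so small $R$ needs no separate
  -- treatment.
  set m := max n₀ 100 with hm
  have hm100 : 100 ≤ m := le_max_right _ _
  refine ⟨8 * C * (4 * m ^ 2) ^ (4 * γ), fun R hR F hF c => ?_⟩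
  have hsR : 1 ≤ Real.sqrt R := Real.one_le_sqrt.mpr hR
  have hY : 1 ≤ m * Real.sqrt R := by nlinarith
  obtain ⟨j, hj1, hj2⟩ := exists_nat_pow_near hY (one_lt_two : (1 : ℝ) < 2)
  set n := 2 ^ (j + 1) with hn
  have hn1 : 1 ≤ n := Nat.one_le_two_pow
  have hncast : (n : ℝ) = 2 ^ (j + 1) := by rw [hn]; push_cast; rfl
  have hnY : m * Real.sqrt R ≤ n := by rw [hncast]; exact hj2.le
  have hnY2 : (n : ℝ) ≤ 2 * (m * Real.sqrt R) := by rw [hncast, pow_succ]; linarith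
  have hn₀ : n₀ ≤ n := by
    have h1 : n₀ ≤ m := le_max_left _ _
    nlinarith
  have hn1' : (1 : ℝ) ≤ n := by exact_mod_cast hn1
  obtain ⟨G, hGm, hGN, hFG⟩ := exists_measurable_bounded_ae_eq hF
  set N := (eLpNorm F ⊤ (volume.restrict unitSquare)).toReal with hN
  have hN0 : 0 ≤ N := ENNReal.toReal_nonneg
  simp only [extensionOp_congr_ae hFG]
  -- The estimate holds on the ball of radius $n^2$; only the much smaller ball of radius $n/100$ is
  -- needed.
  have hQ : ∀ a : Fin n × Fin n → ℂ, (∀ q, ‖a q‖ ≤ 1) →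
      ∫⁻ x in Metric.ball (0 : EuclideanSpace ℝ (Fin 3)) ((n : ℝ) / 100),
        ‖squareSum a x‖ₑ ^ 3 ≤ ENNReal.ofReal (C * ((n : ℝ) ^ 2) ^ (4 * γ)) := fun a ha =>
    (lintegral_mono_set (Metric.ball_subset_ball (by nlinarith))).trans (hC (j + 1) hn₀ a ha 0)
  have key := lintegral_ball_extensionOp_le hn1 hQ hGm hGN c
  have hball : Metric.ball c (Real.sqrt R) ⊆ Metric.ball c ((n : ℝ) / 100) :=
    Metric.ball_subset_ball (by rw [le_div_iff₀ (by norm_num)]; nlinarith)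
  refine setIntegral_le_of_lintegral_le (by positivity) ((lintegral_mono_set hball).trans
    (key.trans ?_))
  rw [← ENNReal.ofReal_ofNat 8, ← ENNReal.ofReal_mul (by norm_num),
    ← ENNReal.ofReal_mul (by positivity)]
  apply ENNReal.ofReal_le_ofReal
  have h1 : ((n : ℝ) ^ 2) ^ (4 * γ) ≤ (4 * m ^ 2) ^ (4 * γ) * R ^ ε := by
    have h2 : (n : ℝ) ^ 2 ≤ 4 * m ^ 2 * R := by
      calc (n : ℝ) ^ 2 ≤ (2 * (m * Real.sqrt R)) ^ 2 := by gcongr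
        _ = 4 * m ^ 2 * R := by rw [mul_pow, mul_pow, Real.sq_sqrt (by linarith)]; ring
    calc ((n : ℝ) ^ 2) ^ (4 * γ) ≤ (4 * m ^ 2 * R) ^ (4 * γ) := by gcongr
      _ = (4 * m ^ 2) ^ (4 * γ) * R ^ (4 * γ) := Real.mul_rpow (by positivity) (by linarith)
      _ ≤ _ := by gcongr
  calc N ^ 3 * (8 * (C * ((n : ℝ) ^ 2) ^ (4 * γ)))
      ≤ N ^ 3 * (8 * (C * ((4 * m ^ 2) ^ (4 * γ) * R ^ ε))) := by gcongr
    _ = _ := by ring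

end

end LargeEnsemble

theorem theorem2p4
    (S : ∀ n M : ℕ, Fin M → Finset (Fin n × Fin n))
    (hS : ∀ n M : ℕ, 1 ≤ n → M ∣ n ^ 2 → LargeEnsemble.IsClassSystem (S n M))
    (γ₀ : ℝ) (hγ₀ : 0 < γ₀)
    (hdec : ∀ γ : ℝ, 0 < γ → γ < γ₀ → LargeEnsemble.AveragedDecoupling S γ) :
    LargeEnsemble.RestrictionConjecture :=
  LargeEnsemble.restrictionConjecture_of_averagedDecoupling S hS γ₀ hγ₀ hdec
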